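/- Let $T=(V,E)$ be a tree on $n\ge 1$ vertices with non-negative rational edge costs $c(e)$, $e\in E$. An edge query $e=\{u,v\}\in E$ costs $c(e)$ and tells whether an unknown vertex $x$ of $T$ lies in $T_u$ or in $T_v$, the connected components of $T-e$ that contain $u$ and $v$, respectively. A decision tree $D$ for $T$ is a rooted binary tree with exactly $n$ leaves whose internal nodes are labelled by edges of $T$ (the two children of a node labelled $\{u,v\}$ corresponding to the answers $T_u$ and $T_v$) and whose leaves are labelled by vertices of $T$, such that for every $x\in V$ following the correct answers for $x$ from the root leads to a leaf labelled $x$. Let $\mathrm{cost}^D(x)$ be the sum of the costs of the queries on that path, let $\mathrm{cost}(D)=\max_{x\in V}\mathrm{cost}^D(x)$, and let $\mathrm{OPT}(T,c)=\min_D \mathrm{cost}(D)$ over all decision trees $D$ for $T$. There is an algorithm that, given $(T,c)$ (the number of vertices and the list of the edges with their costs), outputs a decision tree $D$ for $T$ with $$\mathrm{cost}(D)\le \rho(n)\cdot \mathrm{OPT}(T,c),\qquad \rho(n)=O\!\left(\frac{\log n}{\log\log n}\right),$$ where $\rho$ depends only on $n$, and whose running time is bounded by a polynomial in $n$ that does not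 depend on the costs. Here an algorithm is a fixed program over pointer structures (binary trees with rational numbers at the leaves) with recursive functions, and its running time is the number of elementary steps, where building or reading a pair, a test, a function call, and an addition, subtraction or comparison of two rational numbers each take one step; there is no multiplication, division or rounding. -/

import Mathlib

namespace TreeSearch

/-! ### Decision trees for edge queries on a tree -/

section DecisionTrees

variable {V : Type*}

/-- A rooted binary tree whose leaves carry vertices and whose internal nodes carry queries.
`node u v l r` queries the edge `{u, v}`; the search continues in `l` if the answer is `T_u`
and in `r` if the answer is `T_v`. -/
inductive DecTree (V : Type*) where
  | leaf (v : V) : DecTree V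
  | node (u v : V) (l r : DecTree V) : DecTree V

/-- The number of leaves. -/
def DecTree.numLeaves : DecTree V → ℕ
  | .leaf _ => 1
  | .node _ _ l r => l.numLeaves + r.numLeaves

/-- All queries are edges of `T`. -/
def DecTree.QueriesEdges (T : SimpleGraph V) : DecTree V → Prop
  | .leaf _ => True
  | .node u v l r => T.Adj u v ∧ l.QueriesEdges T ∧ r.QueriesEdges T

/-- `x` lies in `T_u`, the connected component of `u` in `T - {u, v}`. -/
def OnSide (T : SimpleGraph V) (u v x : V) : Prop :=
  (T.deleteEdges {s(u, v)}).Reachable u x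

open Classical in
/-- The vertex that is output when the vertex sought for is `x`. -/
noncomputable def DecTree.search (T : SimpleGraph V) (x : V) : DecTree V → V
  | .leaf v => v
  | .node u v l r => if OnSide T u v x then l.search T x else r.search T x

open Classical in
/-- The sum of the costs of the queries that are asked when the vertex sought for is `x`. -/
noncomputable def DecTree.costAt (T : SimpleGraph V) (c : Sym2 V → ℚ) (x : V) : DecTree V → ℚ
  | .leaf _ => 0
  | .node u v l r => c s(u, v) + if OnSide T u v x then l.costAt T c x else r.costAt T c x

/-- `D` is a decision tree for `T`: it queries edges of `T`, it has `|V|` leaves, and it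
identifies every vertex (in particular, every vertex labels a leaf, hence exactly one). -/
def IsDecisionTree [Fintype V] (T : SimpleGraph V) (D : DecTree V) : Prop :=
  D.QueriesEdges T ∧ D.numLeaves = Fintype.card V ∧ ∀ x, D.search T x = x

/-- The worst-case cost of `D`, the maximum over all vertices `x` of the cost of identifying `x`
(for finite nonempty `V` the supremum is a maximum). -/
noncomputable def cost (T : SimpleGraph V) (c : Sym2 V → ℚ) (D : DecTree V) : ℝ :=
  ⨆ x : V, (D.costAt T c x : ℝ)

/-- The optimal cost of a decision tree for `(T, c)`. (A finite tree has finitely many decision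
trees and at least one, so that the infimum is a minimum.) -/
noncomputable def OPT [Fintype V] (T : SimpleGraph V) (c : Sym2 V → ℚ) : ℝ :=
  sInf (cost T c '' {D | IsDecisionTree T D})

end DecisionTrees

/-! ### The machine model

Programs of a first-order, call-by-value LISP: finitely many recursive one-argument functions over
binary trees (pointer structures) with rational numbers at the leaves. A step is the evaluation of
one expression node: building or reading a pair, a test, a variable, a constant, a function call,
or one addition, subtraction or comparison of two numbers. There is no multiplication, division
or rounding, so that the numbers that occur within `s` steps are integer combinations of the
constants of the program and the numbers in the input with coefficients at most `2 ^ s`, of bit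
length polynomial in `s` and in the bit length of the input. -/

/-- The values: numbers and pairs. The number `0` serves as the empty list and as "false". -/
inductive Val where
  | num (q : ℚ) : Val
  | pair (a b : Val) : Val

/-- Expressions. Variables are de Bruijn indices. -/
inductive Exp where
  /-- the `i`-th innermost variable -/
  | var (i : ℕ) : Exp
  /-- a numerical constant -/
  | const (q : ℚ) : Exp
  /-- a new pair -/
  | pair (a b : Exp) : Exp
  /-- first component of a pair -/
  | fst (a : Exp) : Exp
  /-- second component of a pair -/
  | snd (a : Exp) : Exp
  /-- `1` for a pair, `0` for a number -/
  | isPair (a : Exp) : Exp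
  /-- addition -/
  | add (a b : Exp) : Exp
  /-- subtraction -/
  | sub (a b : Exp) : Exp
  /-- `1` if `a ≤ b`, otherwise `0` -/
  | le (a b : Exp) : Exp
  /-- the value of `b` if that of `a` is `0`, otherwise the value of `t` -/
  | cond (a t b : Exp) : Exp
  /-- `b`, with the value of `a` as its innermost variable -/
  | letIn (a b : Exp) : Exp
  /-- the `f`-th function of the program, applied to `a` -/
  | call (f : ℕ) (a : Exp) : Exp

/-- A program: the bodies of finitely many functions, which may call each other, and a main
expression. The argument of a function is the variable `0` of its body, and the input is the
variable `0` of the main expression. -/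
structure Program where
  /-- the bodies of the functions -/
  funs : List Exp
  /-- the main expression -/
  main : Exp

/-- `Eval F env e v t`: with function bodies `F` and the variables bound by `env`, the evaluation
of `e` stops with value `v` after exactly `t` steps. Evaluations that go wrong (such as adding
a pair) have no value. -/
inductive Eval (F : List Exp) : List Val → Exp → Val → ℕ → Prop
  | var {env : List Val} {i : ℕ} {v : Val} (h : env[i]? = some v) : Eval F env (.var i) v 1
  | const {env : List Val} {q : ℚ} : Eval F env (.const q) (.num q) 1
  | pair {env : List Val} {a b : Exp} {v w : Val} {s t : ℕ} (ha : Eval F env a v s)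
      (hb : Eval F env b w t) : Eval F env (.pair a b) (.pair v w) (s + t + 1)
  | fst {env : List Val} {a : Exp} {v w : Val} {s : ℕ} (ha : Eval F env a (.pair v w) s) :
      Eval F env (.fst a) v (s + 1)
  | snd {env : List Val} {a : Exp} {v w : Val} {s : ℕ} (ha : Eval F env a (.pair v w) s) :
      Eval F env (.snd a) w (s + 1)
  | isPair_pair {env : List Val} {a : Exp} {v w : Val} {s : ℕ}
      (ha : Eval F env a (.pair v w) s) : Eval F env (.isPair a) (.num 1) (s + 1)
  | isPair_num {env : List Val} {a : Exp} {q : ℚ} {s : ℕ} (ha : Eval F env a (.num q) s) :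
      Eval F env (.isPair a) (.num 0) (s + 1)
  | add {env : List Val} {a b : Exp} {p q : ℚ} {s t : ℕ} (ha : Eval F env a (.num p) s)
      (hb : Eval F env b (.num q) t) : Eval F env (.add a b) (.num (p + q)) (s + t + 1)
  | sub {env : List Val} {a b : Exp} {p q : ℚ} {s t : ℕ} (ha : Eval F env a (.num p) s)
      (hb : Eval F env b (.num q) t) : Eval F env (.sub a b) (.num (p - q)) (s + t + 1)
  | le {env : List Val} {a b : Exp} {p q : ℚ} {s t : ℕ} (ha : Eval F env a (.num p) s)
      (hb : Eval F env b (.num q) t) :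
      Eval F env (.le a b) (.num (if p ≤ q then 1 else 0)) (s + t + 1)
  | cond_true {env : List Val} {a b c : Exp} {v w : Val} {s t : ℕ} (ha : Eval F env a v s)
      (hv : v ≠ .num 0) (hb : Eval F env b w t) : Eval F env (.cond a b c) w (s + t + 1)
  | cond_false {env : List Val} {a b c : Exp} {w : Val} {s t : ℕ}
      (ha : Eval F env a (.num 0) s) (hc : Eval F env c w t) :
      Eval F env (.cond a b c) w (s + t + 1)
  | letIn {env : List Val} {a b : Exp} {v w : Val} {s t : ℕ} (ha : Eval F env a v s)
      (hb : Eval F (v :: env) b w t) : Eval F env (.letIn a b) w (s + t + 1)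
  | call {env : List Val} {f : ℕ} {a body : Exp} {v w : Val} {s t : ℕ}
      (hf : F[f]? = some body) (ha : Eval F env a v s) (hb : Eval F [v] body w t) :
      Eval F env (.call f a) w (s + t + 1)

/-- Evaluation is deterministic: value and number of steps are determined. -/
theorem Eval.det {F : List Exp} {env : List Val} {e : Exp} {v : Val} {t : ℕ}
    (h : Eval F env e v t) : ∀ {v' : Val} {t' : ℕ}, Eval F env e v' t' → v' = v ∧ t' = t := by
  induction h with
  | var h => intro v' t' h'; cases h' with | var h2 => simp_all
  | const => intro v' t' h'; cases h'; simp
  | pair _ _ iha ihb =>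
    intro v' t' h'
    cases h' with | pair h1 h2 => have := iha h1; have := ihb h2; simp_all
  | fst _ iha => intro v' t' h'; cases h' with | fst h1 => have := iha h1; simp_all
  | snd _ iha => intro v' t' h'; cases h' with | snd h1 => have := iha h1; simp_all
  | isPair_pair _ iha =>
    intro v' t' h'
    cases h' with
    | isPair_pair h1 => have := iha h1; simp_all
    | isPair_num h1 => have := iha h1; simp_all
  | isPair_num _ iha =>
    intro v' t' h'
    cases h' with
    | isPair_pair h1 => have := iha h1; simp_all
    | isPair_num h1 => have := iha h1; simp_all
  | add _ _ iha ihb =>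
    intro v' t' h'
    cases h' with | add h1 h2 => have := iha h1; have := ihb h2; simp_all
  | sub _ _ iha ihb =>
    intro v' t' h'
    cases h' with | sub h1 h2 => have := iha h1; have := ihb h2; simp_all
  | le _ _ iha ihb =>
    intro v' t' h'
    cases h' with | le h1 h2 => have := iha h1; have := ihb h2; simp_all
  | cond_true _ hv _ iha ihb =>
    intro v' t' h'
    cases h' with
    | cond_true h1 _ h2 => have := iha h1; have := ihb h2; simp_all
    | cond_false h1 h2 => exact absurd (iha h1).1.symm hv
  | cond_false _ _ iha ihb =>
    intro v' t' h'
    cases h' with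
    | cond_true h1 hv h2 => exact absurd (iha h1).1 hv
    | cond_false h1 h2 => have := iha h1; have := ihb h2; simp_all
  | letIn _ _ iha ihb =>
    intro v' t' h'
    cases h' with
    | letIn h1 h2 =>
      obtain ⟨rfl, rfl⟩ := iha h1
      obtain ⟨rfl, rfl⟩ := ihb h2
      simp
  | call hf _ _ iha ihb =>
    intro v' t' h'
    cases h' with
    | call hf' h1 h2 =>
      obtain rfl := Option.some.inj (hf.symm.trans hf')
      obtain ⟨rfl, rfl⟩ := iha h1
      obtain ⟨rfl, rfl⟩ := ihb h2
      simp

/-- On the given input, the program stops with the given output after exactly `t` steps. -/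
def Program.Outputs (P : Program) (input output : Val) (t : ℕ) : Prop :=
  Eval P.funs [input] P.main output t

/-! ### Input and output formats -/

/-- `L` lists every edge of `T` exactly once, in any order, as a triple of its two endpoints
(in either order) and its cost. -/
def ListsEdges {V : Type*} (T : SimpleGraph V) (c : Sym2 V → ℚ) (L : List (V × V × ℚ)) : Prop :=
  (L.map fun x => s(x.1, x.2.1)).Nodup ∧
    (∀ e, e ∈ L.map (fun x => s(x.1, x.2.1)) ↔ e ∈ T.edgeSet) ∧
    ∀ x ∈ L, x.2.2 = c s(x.1, x.2.1)

/-- A vertex is represented by its number. -/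
def encodeVertex {n : ℕ} (v : Fin n) : Val := .num (v : ℕ)

/-- A list of edges with costs, as a linked list of triples. -/
def encodeEdges {n : ℕ} : List (Fin n × Fin n × ℚ) → Val
  | [] => .num 0
  | x :: L => .pair (.pair (encodeVertex x.1) (.pair (encodeVertex x.2.1) (.num x.2.2)))
      (encodeEdges L)

/-- An instance with vertex set `{0, …, n - 1}`: the number of vertices and the list of edges. -/
def encodeInput (n : ℕ) (L : List (Fin n × Fin n × ℚ)) : Val := .pair (.num n) (encodeEdges L)

/-- A decision tree as a value. -/
def encodeDecTree {n : ℕ} : DecTree (Fin n) → Val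
  | .leaf v => encodeVertex v
  | .node u v l r =>
    .pair (.pair (encodeVertex u) (encodeVertex v)) (.pair (encodeDecTree l) (encodeDecTree r))

end TreeSearch

/-! The candidates for the unknown vertex always form a set `A` containing both ends of every edge
that splits it (`SplitClosed`); for nonempty `A` this means a subtree. Fix a number `q`. One level
of the search picks a set `X ⊆ A` of at most `q + 1` vertices such that every connected piece of `A`
that avoids `X` has fewer than `|A| / q` vertices (`computes_sep`). Then it proceeds in two stages,
each of cost at most OPT.

In the first stage a cheapest strategy for telling the elements of `X` apart is followed. A decision
tree for `T` tells them apart too, so the cost of this strategy is a lower bound for OPT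
(`lowerBound_of_splits`, `findsBest`). It leaves candidates among which there is exactly one `x ∈
X`. In the second stage the edges at `x` are queried. Every decision tree has to query all of them
in order to identify `x`, so their sum is a lower bound as well (`starSum_le_costAt`). What remains
is `x` itself or a piece that avoids `X`, on which the search recurses (`computes_star`,
`computes_expand`, `solves`). Sizes drop by a factor `q` per level, so the ratio is at most `2 *
(Nat.clog q n + 1)`.

For the best strategy on `X` only the way in which an edge splits `X` matters, and of all edges with
the same split the cheapest will do. This leaves at most `2 ^ |X|` first queries, hence time `2 ^
O(q ^ 2)` up to polynomial factors, by plain recursion. The number `q` is chosen with `2 ^ q.choose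
2 ≤ 2 * n < 2 ^ (q + 1).choose 2`. The first inequality makes the search polynomial
(`pow_search_le`); the second makes `log q` at least half of `log (log n)`, which gives the ratio
(`isBigO_clog`). -/

namespace TreeSearch

/-! ### Equational evaluation -/

open Classical in
/-- The value of an expression together with the number of steps, if there is one. -/
noncomputable def run (F : List Exp) (env : List Val) (e : Exp) : Option (Val × ℕ) :=
  if h : ∃ p : Val × ℕ, Eval F env e p.1 p.2 then some h.choose else none

/-- Evaluation is deterministic, so the pair picked by choice is the only one. The relation `Eval`
can thus be replaced by a function, about which one can compute by rewriting. -/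
theorem run_eq_some {F : List Exp} {env : List Val} {e : Exp} {p : Val × ℕ} :
    run F env e = some p ↔ Eval F env e p.1 p.2 := by
  unfold run
  split_ifs with h
  · constructor
    · intro hp
      cases hp
      exact h.choose_spec
    · intro hp
      have := hp.det h.choose_spec
      exact congrArg some (Prod.ext this.1 this.2)
  · simp only [false_iff]
    exact fun hp => h ⟨p, hp⟩

section Equations

variable (F : List Exp) (env : List Val)

theorem run_var (i : ℕ) : run F env (.var i) = env[i]?.bind fun v => some (v, 1) := by
  ext ⟨v, t⟩
  rw [run_eq_some, Option.bind_eq_some_iff]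
  constructor
  · rintro ⟨h⟩
    exact ⟨v, h, rfl⟩
  · rintro ⟨w, h, hw⟩
    cases hw
    exact .var h

theorem run_const (q : ℚ) : run F env (.const q) = some (.num q, 1) :=
  run_eq_some.2 .const

theorem run_pair (a b : Exp) : run F env (.pair a b) =
    (run F env a).bind fun p => (run F env b).bind fun q => some (.pair p.1 q.1, p.2 + q.2 + 1) := by
  ext ⟨v, t⟩
  simp only [run_eq_some, Option.bind_eq_some_iff]
  constructor
  · intro h
    cases h with | pair h1 h2 => exact ⟨(_, _), h1, (_, _), h2, rfl⟩
  · rintro ⟨p, h1, q, h2, h⟩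
    cases h
    exact .pair h1 h2

theorem run_fst (a : Exp) : run F env (.fst a) =
    (run F env a).bind fun p => match p.1 with
      | .pair v _ => some (v, p.2 + 1)
      | .num _ => none := by
  ext ⟨v, t⟩
  simp only [run_eq_some, Option.bind_eq_some_iff]
  constructor
  · intro h
    cases h with | fst h1 => exact ⟨(_, _), h1, rfl⟩
  · rintro ⟨⟨_ | ⟨x, y⟩, s⟩, h1, h⟩
    · cases h
    · cases h
      exact .fst h1

theorem run_snd (a : Exp) : run F env (.snd a) =
    (run F env a).bind fun p => match p.1 with
      | .pair _ v => some (v, p.2 + 1)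
      | .num _ => none := by
  ext ⟨v, t⟩
  simp only [run_eq_some, Option.bind_eq_some_iff]
  constructor
  · intro h
    cases h with | snd h1 => exact ⟨(_, _), h1, rfl⟩
  · rintro ⟨⟨_ | ⟨x, y⟩, s⟩, h1, h⟩
    · cases h
    · cases h
      exact .snd h1

theorem run_isPair (a : Exp) : run F env (.isPair a) =
    (run F env a).bind fun p => match p.1 with
      | .pair _ _ => some (.num 1, p.2 + 1)
      | .num _ => some (.num 0, p.2 + 1) := by
  ext ⟨v, t⟩
  simp only [run_eq_some, Option.bind_eq_some_iff]
  constructor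
  · intro h
    cases h with
    | isPair_pair h1 => exact ⟨(_, _), h1, rfl⟩
    | isPair_num h1 => exact ⟨(_, _), h1, rfl⟩
  · rintro ⟨⟨_ | ⟨x, y⟩, s⟩, h1, h⟩
    · cases h
      exact .isPair_num h1
    · cases h
      exact .isPair_pair h1

theorem run_add (a b : Exp) : run F env (.add a b) =
    (run F env a).bind fun p => (run F env b).bind fun q => match p.1, q.1 with
      | .num x, .num y => some (.num (x + y), p.2 + q.2 + 1)
      | _, _ => none := by
  ext ⟨v, t⟩
  simp only [run_eq_some, Option.bind_eq_some_iff]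
  constructor
  · intro h
    cases h with | add h1 h2 => exact ⟨(_, _), h1, (_, _), h2, rfl⟩
  · rintro ⟨⟨x | _, s⟩, h1, ⟨y | _, s'⟩, h2, h⟩ <;> cases h
    exact .add h1 h2

theorem run_sub (a b : Exp) : run F env (.sub a b) =
    (run F env a).bind fun p => (run F env b).bind fun q => match p.1, q.1 with
      | .num x, .num y => some (.num (x - y), p.2 + q.2 + 1)
      | _, _ => none := by
  ext ⟨v, t⟩
  simp only [run_eq_some, Option.bind_eq_some_iff]
  constructor
  · intro h
    cases h with | sub h1 h2 => exact ⟨(_, _), h1, (_, _), h2, rfl⟩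
  · rintro ⟨⟨x | _, s⟩, h1, ⟨y | _, s'⟩, h2, h⟩ <;> cases h
    exact .sub h1 h2

theorem run_le (a b : Exp) : run F env (.le a b) =
    (run F env a).bind fun p => (run F env b).bind fun q => match p.1, q.1 with
      | .num x, .num y => some (.num (if x ≤ y then 1 else 0), p.2 + q.2 + 1)
      | _, _ => none := by
  ext ⟨v, t⟩
  simp only [run_eq_some, Option.bind_eq_some_iff]
  constructor
  · intro h
    cases h with | le h1 h2 => exact ⟨(_, _), h1, (_, _), h2, rfl⟩
  · rintro ⟨⟨x | _, s⟩, h1, ⟨y | _, s'⟩, h2, h⟩ <;> cases h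
    exact .le h1 h2

theorem run_cond (a b c : Exp) : run F env (.cond a b c) =
    (run F env a).bind fun p => match p.1 with
      | .num x => if x = 0 then (run F env c).bind fun q => some (q.1, p.2 + q.2 + 1)
          else (run F env b).bind fun q => some (q.1, p.2 + q.2 + 1)
      | .pair _ _ => (run F env b).bind fun q => some (q.1, p.2 + q.2 + 1) := by
  ext ⟨v, t⟩
  simp only [run_eq_some, Option.bind_eq_some_iff]
  constructor
  · intro h
    cases h with
    | @cond_true _ _ _ _ w _ s _ h1 hv h2 =>
      refine ⟨(_, _), h1, ?_⟩
      cases w with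
      | num x =>
        have : x ≠ 0 := fun h => hv (by rw [h])
        simp only [this, if_false, Option.bind_eq_some_iff]
        exact ⟨(_, _), run_eq_some.2 h2, rfl⟩
      | pair =>
        simp only [Option.bind_eq_some_iff]
        exact ⟨(_, _), run_eq_some.2 h2, rfl⟩
    | cond_false h1 h2 =>
      refine ⟨(_, _), h1, ?_⟩
      simp only [if_true, Option.bind_eq_some_iff]
      exact ⟨(_, _), run_eq_some.2 h2, rfl⟩
  · rintro ⟨⟨x | _, s⟩, h1, h⟩
    · by_cases hx : x = 0
      · simp only [hx, if_true, Option.bind_eq_some_iff, run_eq_some] at h h1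
        obtain ⟨q, h2, h⟩ := h
        cases h
        exact .cond_false h1 h2
      · simp only [hx, if_false, Option.bind_eq_some_iff, run_eq_some] at h h1
        obtain ⟨q, h2, h⟩ := h
        cases h
        exact .cond_true h1 (by simpa using hx) h2
    · simp only [Option.bind_eq_some_iff, run_eq_some] at h h1
      obtain ⟨q, h2, h⟩ := h
      cases h
      exact .cond_true h1 (by simp) h2

theorem run_letIn (a b : Exp) : run F env (.letIn a b) =
    (run F env a).bind fun p => (run F (p.1 :: env) b).bind fun q =>
      some (q.1, p.2 + q.2 + 1) := by
  ext ⟨v, t⟩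
  simp only [run_eq_some, Option.bind_eq_some_iff]
  constructor
  · intro h
    cases h with | letIn h1 h2 => exact ⟨(_, _), h1, (_, _), h2, rfl⟩
  · rintro ⟨p, h1, q, h2, h⟩
    cases h
    exact .letIn h1 h2

/-- The value of the `f`-th function, together with the number of steps. -/
noncomputable def fn (F : List Exp) (f : ℕ) (v : Val) : Option (Val × ℕ) :=
  F[f]?.bind fun b => run F [v] b

/-- A call is reduced to `fn` and no further. Used as simp lemmas, these equations execute one
function body symbolically and leave its calls to the specifications of the called functions. -/
theorem run_call (f : ℕ) (a : Exp) : run F env (.call f a) =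
    (run F env a).bind fun p => (fn F f p.1).bind fun q => some (q.1, p.2 + q.2 + 1) := by
  ext ⟨v, t⟩
  simp only [run_eq_some, Option.bind_eq_some_iff, fn]
  constructor
  · intro h
    cases h with | call hf h1 h2 => exact ⟨(_, _), h1, (_, _), ⟨_, hf, h2⟩, rfl⟩
  · rintro ⟨p, h1, q, ⟨b, hf, h2⟩, h⟩
    cases h
    exact .call hf h1 h2

end Equations

/-! ### The program

Tuples are nested to the right; `rest` and `comp` access their components. -/

/-- The tuple that remains of the variable `i` after dropping `j` components. -/
def rest (i : ℕ) : ℕ → Exp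
  | 0 => .var i
  | j + 1 => .snd (rest i j)

/-- The component `j` (not the last one) of the tuple in the variable `i`. -/
def comp (i j : ℕ) : Exp := .fst (rest i j)

/-- First endpoint of an edge record `((u, v), c, S)`. -/
def eU (e : Exp) : Exp := .fst (.fst e)
/-- Second endpoint of an edge record. -/
def eV (e : Exp) : Exp := .snd (.fst e)
/-- Cost of an edge record. -/
def eC (e : Exp) : Exp := .fst (.snd e)
/-- Side of the first endpoint, in an edge record. -/
def eS (e : Exp) : Exp := .snd (.snd e)

/-- `(x, y) ↦ [x = y]` -/
def eqB : Exp := .cond (.le (comp 0 0) (rest 0 1)) (.le (rest 0 1) (comp 0 0)) (.const 0)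

/-- `(x, S) ↦ [x ∈ S]` -/
def memB : Exp := .cond (.isPair (rest 0 1))
  (.cond (.call 0 (.pair (comp 0 0) (comp 0 1))) (.const 1)
    (.call 1 (.pair (comp 0 0) (rest 0 2)))) (.const 0)

/-- `(A, S) ↦ A ∩ S` -/
def interB : Exp := .cond (.isPair (comp 0 0))
  (.cond (.call 1 (.pair (.fst (comp 0 0)) (rest 0 1)))
    (.pair (.fst (comp 0 0)) (.call 2 (.pair (.snd (comp 0 0)) (rest 0 1))))
    (.call 2 (.pair (.snd (comp 0 0)) (rest 0 1)))) (.const 0)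

/-- `(A, S) ↦ A \ S` -/
def diffB : Exp := .cond (.isPair (comp 0 0))
  (.cond (.call 1 (.pair (.fst (comp 0 0)) (rest 0 1)))
    (.call 3 (.pair (.snd (comp 0 0)) (rest 0 1)))
    (.pair (.fst (comp 0 0)) (.call 3 (.pair (.snd (comp 0 0)) (rest 0 1))))) (.const 0)

/-- length of a list -/
def lenB : Exp := .cond (.isPair (.var 0)) (.add (.const 1) (.call 4 (.snd (.var 0)))) (.const 0)

/-- equality of lists of numbers -/
def eqLB : Exp := .cond (.isPair (comp 0 0))
  (.cond (.isPair (rest 0 1))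
    (.cond (.call 0 (.pair (.fst (comp 0 0)) (comp 0 1)))
      (.call 5 (.pair (.snd (comp 0 0)) (rest 0 2))) (.const 0)) (.const 0))
  (.cond (.isPair (rest 0 1)) (.const 0) (.const 1))

/-- the pair of least first component in a list of pairs -/
def argminB : Exp := .cond (.isPair (.var 0))
  (.letIn (.call 6 (.snd (.var 0)))
    (.cond (.isPair (.var 0))
      (.cond (.le (.fst (comp 1 0)) (comp 0 0)) (comp 1 0) (.var 0)) (comp 1 0))) (.const 0)

/-- `(Q, x) ↦ 2 ^ |Q| * x` -/
def dblB : Exp := .cond (.isPair (comp 0 0))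
  (.call 7 (.pair (.snd (comp 0 0)) (.add (rest 0 1) (rest 0 1)))) (rest 0 1)

/-- `(n, Q, N)`: lengthen `Q` as long as `N`, multiplied by `2 ^ |Q|` each time, is at most `n`. -/
def findB : Exp := .letIn (.call 7 (.pair (comp 0 1) (rest 0 2)))
  (.cond (.le (.var 0) (comp 1 0))
    (.call 8 (.pair (comp 1 0) (.pair (.pair (.const 1) (comp 1 1)) (.var 0)))) (comp 1 1))

/-- `(Q, x) ↦ |Q| * x` -/
def mulB : Exp := .cond (.isPair (comp 0 0))
  (.add (rest 0 1) (.call 9 (.pair (.snd (comp 0 0)) (rest 0 1)))) (.const 0)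

/-- `(L, u, v)`: the list of edges `L` without `(u, v)` -/
def withoutB : Exp := .cond (.isPair (comp 0 0))
  (.cond (.cond (.call 0 (.pair (.fst (.fst (comp 0 0))) (comp 0 1)))
      (.call 0 (.pair (.fst (.snd (.fst (comp 0 0)))) (rest 0 2))) (.const 0))
    (.call 10 (.pair (.snd (comp 0 0)) (rest 0 1)))
    (.pair (.fst (comp 0 0)) (.call 10 (.pair (.snd (comp 0 0)) (rest 0 1))))) (.const 0)

/-- `(L, S)`: one round of adding to `S` the neighbours with respect to the edges in `L` -/
def growB : Exp := .cond (.isPair (comp 0 0))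
  (.cond (.cond (.call 1 (.pair (.fst (.fst (comp 0 0))) (rest 0 1))) (.const 1)
      (.call 1 (.pair (.fst (.snd (.fst (comp 0 0)))) (rest 0 1))))
    (.call 11 (.pair (.snd (comp 0 0)) (.pair (.fst (.fst (comp 0 0)))
      (.pair (.fst (.snd (.fst (comp 0 0)))) (rest 0 1)))))
    (.call 11 (.pair (.snd (comp 0 0)) (rest 0 1)))) (rest 0 1)

/-- `(K, L, S)`: `|K|` rounds of adding neighbours to `S` -/
def roundsB : Exp := .cond (.isPair (comp 0 0))
  (.call 12 (.pair (.snd (comp 0 0)) (.pair (comp 0 1) (.call 11 (rest 0 1))))) (rest 0 2)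

/-- `(L, M, K)`: the records of the edges in `L`, in both orientations, with respect to the tree
with list of edges `M` -/
def tableB : Exp := .cond (.isPair (comp 0 0))
  (.letIn (.fst (comp 0 0))
    (.letIn (.call 10 (.pair (comp 1 1) (.pair (comp 0 0) (comp 0 1))))
      (.pair (.pair (.pair (comp 1 0) (comp 1 1)) (.pair (rest 1 2)
          (.call 12 (.pair (rest 2 2) (.pair (.var 0) (.pair (comp 1 0) (.const 0)))))))
        (.pair (.pair (.pair (comp 1 1) (comp 1 0)) (.pair (rest 1 2)
            (.call 12 (.pair (rest 2 2) (.pair (.var 0) (.pair (comp 1 1) (.const 0)))))))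
          (.call 13 (.pair (.snd (comp 2 0)) (rest 2 1))))))) (.const 0)

/-- `(E, R, m, Q)`: the records `((u, v), c, S)` in `E` with `u ∈ R` and `m ≤ |Q| * |R ∩ S|`,
together with `|R ∩ S|` -/
def sepCandsB : Exp := .cond (.isPair (comp 0 0))
  (.letIn (.call 4 (.call 2 (.pair (comp 0 1) (eS (.fst (comp 0 0))))))
    (.cond (.cond (.call 1 (.pair (eU (.fst (comp 1 0))) (comp 1 1)))
        (.le (comp 1 2) (.call 9 (.pair (rest 1 3) (.var 0)))) (.const 0))
      (.pair (.pair (.var 0) (.fst (comp 1 0))) (.call 14 (.pair (.snd (comp 1 0)) (rest 1 1))))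
      (.call 14 (.pair (.snd (comp 1 0)) (rest 1 1))))) (.const 0)

/-- `(R, m, Q, E)`: a separator of `R` -/
def sepB : Exp := .letIn (.call 6 (.call 14
    (.pair (rest 0 3) (.pair (comp 0 0) (.pair (comp 0 1) (comp 0 2))))))
  (.cond (.isPair (.var 0))
    (.pair (eU (rest 0 1)) (.call 15 (.pair (.call 3 (.pair (comp 1 0) (eS (rest 0 1))))
      (rest 1 1))))
    (.cond (.isPair (comp 1 0)) (.pair (.fst (comp 1 0)) (.const 0)) (.const 0)))

/-- `(x, l, m)`: `x` in front of each list in `l`, followed by the lists in `m` -/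
def consAllB : Exp := .cond (.isPair (comp 0 1))
  (.pair (.pair (comp 0 0) (.fst (comp 0 1)))
    (.call 16 (.pair (comp 0 0) (.pair (.snd (comp 0 1)) (rest 0 2))))) (rest 0 2)

/-- the sublists of a list -/
def subsB : Exp := .cond (.isPair (.var 0))
  (.letIn (.call 17 (.snd (.var 0))) (.call 16 (.pair (comp 1 0) (.pair (.var 0) (.var 0)))))
  (.pair (.const 0) (.const 0))

/-- `(E, X, Y)`: the records `((u, v), c, S)` in `E` with `X ∩ S = Y`, together with `c` -/
def splitCandsB : Exp := .cond (.isPair (comp 0 0))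
  (.cond (.call 5 (.pair (.call 2 (.pair (comp 0 1) (eS (.fst (comp 0 0))))) (rest 0 2)))
    (.pair (.pair (eC (.fst (comp 0 0))) (.fst (comp 0 0)))
      (.call 18 (.pair (.snd (comp 0 0)) (rest 0 1))))
    (.call 18 (.pair (.snd (comp 0 0)) (rest 0 1)))) (.const 0)

/-- `(Y, X, E)`: the best strategies for `X` that ask first for an edge that splits off one of
the lists in `Y`, together with their costs -/
def bestAllB : Exp := .cond (.isPair (comp 0 0))
  (.letIn (.call 6 (.call 18 (.pair (rest 0 2) (.pair (comp 0 1) (.fst (comp 0 0))))))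
    (.cond (.isPair (.var 0))
      (.letIn (.call 3 (.pair (comp 1 1) (eS (rest 0 1))))
        (.cond (.cond (.isPair (.fst (comp 2 0))) (.isPair (.var 0)) (.const 0))
          (.letIn (.call 20 (.pair (.fst (comp 2 0)) (rest 2 2)))
            (.letIn (.call 20 (.pair (.var 1) (rest 3 2)))
              (.pair (.pair (.add (comp 3 0)
                  (.cond (.le (comp 1 0) (comp 0 0)) (comp 0 0) (comp 1 0)))
                  (.pair (rest 3 1) (.pair (rest 1 1) (rest 0 1))))
                (.call 19 (.pair (.snd (comp 4 0)) (rest 4 1))))))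
          (.call 19 (.pair (.snd (comp 2 0)) (rest 2 1)))))
      (.call 19 (.pair (.snd (comp 1 0)) (rest 1 1))))) (.const 0)

/-- `(X, E)`: the best strategy that tells the elements of `X` apart, and its cost -/
def bestB : Exp := .cond (.isPair (.snd (comp 0 0)))
  (.call 6 (.call 19 (.pair (.call 17 (comp 0 0)) (.var 0))))
  (.pair (.const 0) (.fst (comp 0 0)))

/-- `(F, x, A, Q, E)`: query the edges in `F` that end in `x`, and search on in the components -/
def starB : Exp := .cond (.isPair (comp 0 0))
  (.letIn (.call 2 (.pair (comp 0 2) (eS (.fst (comp 0 0)))))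
    (.cond (.cond (.call 0 (.pair (eV (.fst (comp 1 0))) (comp 1 1))) (.isPair (.var 0)) (.const 0))
      (.pair (.fst (.fst (comp 1 0)))
        (.pair (.call 23 (.pair (.var 0) (rest 1 3)))
          (.call 21 (.pair (.snd (comp 1 0)) (.pair (comp 1 1)
            (.pair (.call 3 (.pair (comp 1 2) (eS (.fst (comp 1 0))))) (rest 1 3)))))))
      (.call 21 (.pair (.snd (comp 1 0)) (rest 1 1))))) (comp 0 1)

/-- `(K, A, Q, E)`: extend the strategy `K` to the candidates in `A` -/
def expandB : Exp := .cond (.isPair (comp 0 0))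
  (.pair (.fst (.fst (comp 0 0)))
    (.pair (.call 22 (.pair (.fst (.snd (comp 0 0)))
        (.pair (.call 2 (.pair (comp 0 1) (eS (.fst (comp 0 0))))) (rest 0 2))))
      (.call 22 (.pair (.snd (.snd (comp 0 0)))
        (.pair (.call 3 (.pair (comp 0 1) (eS (.fst (comp 0 0))))) (rest 0 2))))))
  (.call 21 (.pair (rest 0 3) (.var 0)))

/-- `(A, Q, E)`: a decision tree for the candidates in `A` -/
def solveB : Exp := .letIn (.call 20 (.pair
    (.call 15 (.pair (comp 0 0) (.pair (.call 4 (comp 0 0)) (rest 0 1)))) (rest 0 2)))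
  (.call 22 (.pair (rest 0 1) (.var 1)))

/-- `n ↦ (n - 1, …, 0)` -/
def iotaB : Exp := .cond (.le (.var 0) (.const 0)) (.const 0)
  (.letIn (.sub (.var 0) (.const 1)) (.pair (.var 0) (.call 24 (.var 0))))

/-- The functions of the program. -/
def prog : List Exp :=
  [eqB, memB, interB, diffB, lenB, eqLB, argminB, dblB, findB, mulB, withoutB, growB, roundsB,
    tableB, sepCandsB, sepB, consAllB, subsB, splitCandsB, bestAllB, bestB, starB, expandB,
    solveB, iotaB]

/-- The main expression. -/
def mainB : Exp := .letIn (.call 24 (comp 0 0))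
  (.letIn (.call 8 (.pair (comp 1 0) (.pair (.pair (.const 1) (.pair (.const 1) (.const 0)))
      (.const 1))))
    (.letIn (.call 13 (.pair (rest 2 1) (.pair (rest 2 1) (.var 1))))
      (.call 23 (.pair (.var 2) (.pair (.var 1) (.var 0))))))

/-- Evaluation of the function `f` of the program at `v` yields `w` within `N` steps. -/
def Computes (f : ℕ) (v w : Val) (N : ℕ) : Prop := ∃ t ≤ N, fn prog f v = some (w, t)

/-! ### The auxiliary functions of the program -/

attribute [simp] run_var run_const run_pair run_fst run_snd run_isPair run_add run_sub run_le
  run_cond run_letIn run_call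

/-- A list as a value. -/
def encL {α : Type*} (f : α → Val) : List α → Val
  | [] => .num 0
  | a :: l => .pair (f a) (encL f l)

@[simp] theorem encL_nil {α : Type*} (f : α → Val) : encL f [] = .num 0 := rfl

@[simp] theorem encL_cons {α : Type*} (f : α → Val) (a : α) (l : List α) :
    encL f (a :: l) = .pair (f a) (encL f l) := rfl

/-- A number in unary. -/
def unary : ℕ → Val
  | 0 => .num 0
  | q + 1 => .pair (.num 1) (unary q)

theorem Computes.mono {f : ℕ} {v w : Val} {M N : ℕ} (h : Computes f v w M) (hMN : M ≤ N) :
    Computes f v w N := by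
  obtain ⟨t, ht, h⟩ := h
  exact ⟨t, ht.trans hMN, h⟩

theorem fn_prog {f : ℕ} {b : Exp} (h : prog[f]? = some b) (v : Val) :
    fn prog f v = run prog [v] b := by
  simp [fn, h]

/-- The pattern of all specifications `computes_*`: get the values of the calls from earlier results
or from induction, execute the body by `simp`, and compare step counts. The numerical constants in
the time bounds are generous. -/
theorem computes_eq (x y : ℚ) :
    Computes 0 (.pair (.num x) (.num y)) (.num (if x = y then 1 else 0)) 20 := by
  unfold Computes
  rw [fn_prog (b := eqB) rfl]
  rcases lt_trichotomy x y with h | h | h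
  · simp [eqB, comp, rest, h.ne, h.not_ge, h.le]
  · simp [eqB, comp, rest, h]
  · simp [eqB, comp, rest, h.ne', h.not_ge, h.le]

variable {n : ℕ}

/-- A list of vertices as a value. -/
abbrev encS (S : List (Fin n)) : Val := encL encodeVertex S

theorem computes_eq_vertex (x y : Fin n) :
    Computes 0 (.pair (encodeVertex x) (encodeVertex y)) (.num (if x = y then 1 else 0)) 20 := by
  have h := computes_eq ((x : ℕ) : ℚ) ((y : ℕ) : ℚ)
  simp only [Nat.cast_inj, Fin.val_inj] at h
  exact h

theorem computes_mem (x : Fin n) (S : List (Fin n)) :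
    Computes 1 (.pair (encodeVertex x) (encS S)) (.num (if x ∈ S then 1 else 0))
      (60 * S.length + 20) := by
  induction S with
  | nil =>
    unfold Computes
    rw [fn_prog (b := memB) rfl]
    simp [memB, comp, rest]
  | cons y S ih =>
    obtain ⟨t, ht, h⟩ := ih
    obtain ⟨s, hs, h'⟩ := computes_eq_vertex x y
    unfold Computes
    rw [fn_prog (b := memB) rfl]
    by_cases hxy : x = y
    · subst hxy
      simp only [if_true] at h'
      simp [memB, comp, rest, h']
      omega
    · simp only [if_neg hxy] at h'
      simp [memB, comp, rest, h', h, hxy]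
      omega

/-- The elements of `A` that belong to `S`. -/
def inter (A S : List (Fin n)) : List (Fin n) := A.filter (· ∈ S)

/-- The elements of `A` that do not belong to `S`. -/
def diff (A S : List (Fin n)) : List (Fin n) := A.filter (· ∉ S)

@[simp] theorem mem_inter {A S : List (Fin n)} {x : Fin n} :
    x ∈ inter A S ↔ x ∈ A ∧ x ∈ S := by simp [inter]

@[simp] theorem mem_diff {A S : List (Fin n)} {x : Fin n} :
    x ∈ diff A S ↔ x ∈ A ∧ x ∉ S := by simp [diff]

theorem nodup_inter {A : List (Fin n)} (h : A.Nodup) (S : List (Fin n)) : (inter A S).Nodup :=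
  h.filter _

theorem nodup_diff {A : List (Fin n)} (h : A.Nodup) (S : List (Fin n)) : (diff A S).Nodup :=
  h.filter _

theorem length_inter_add (A S : List (Fin n)) :
    (inter A S).length + (diff A S).length = A.length := by
  induction A with
  | nil => rfl
  | cons x A ih =>
    by_cases hx : x ∈ S <;> simp [hx, inter, diff] at ih ⊢ <;> omega

theorem computes_inter (A S : List (Fin n)) :
    Computes 2 (.pair (encS A) (encS S)) (encS (inter A S))
      ((60 * S.length + 60) * A.length + 20) := by
  induction A with
  | nil =>
    unfold Computes
    rw [fn_prog (b := interB) rfl]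
    simp [interB, comp, rest, inter]
  | cons y A ih =>
    obtain ⟨t, ht, h⟩ := ih
    obtain ⟨s, hs, h'⟩ := computes_mem y S
    unfold Computes
    rw [fn_prog (b := interB) rfl]
    rw [List.length_cons, mul_add, mul_one]
    by_cases hy : y ∈ S
    · simp only [hy, if_true] at h'
      rw [inter] at h ⊢
      simp [interB, comp, rest, h', h, hy]
      omega
    · simp only [hy, if_false] at h'
      rw [inter] at h ⊢
      simp [interB, comp, rest, h', h, hy]
      omega

theorem computes_diff (A S : List (Fin n)) :
    Computes 3 (.pair (encS A) (encS S)) (encS (diff A S))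
      ((60 * S.length + 60) * A.length + 20) := by
  induction A with
  | nil =>
    unfold Computes
    rw [fn_prog (b := diffB) rfl]
    simp [diffB, comp, rest, diff]
  | cons y A ih =>
    obtain ⟨t, ht, h⟩ := ih
    obtain ⟨s, hs, h'⟩ := computes_mem y S
    unfold Computes
    rw [fn_prog (b := diffB) rfl]
    rw [List.length_cons, mul_add, mul_one]
    by_cases hy : y ∈ S
    · simp only [hy, if_true] at h'
      rw [diff] at h ⊢
      simp [diffB, comp, rest, h', h, hy] at *
      omega
    · simp only [hy, if_false] at h'
      rw [diff] at h ⊢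
      simp [diffB, comp, rest, h', h, hy] at *
      omega

theorem computes_len {α : Type*} (f : α → Val) (A : List α) :
    Computes 4 (encL f A) (.num A.length) (20 * A.length + 20) := by
  induction A with
  | nil =>
    unfold Computes
    rw [fn_prog (b := lenB) rfl]
    simp [lenB]
  | cons y A ih =>
    obtain ⟨t, ht, h⟩ := ih
    unfold Computes
    rw [fn_prog (b := lenB) rfl]
    simp [lenB, h, add_comm]
    omega

theorem computes_eqL (A B : List (Fin n)) :
    Computes 5 (.pair (encS A) (encS B)) (.num (if A = B then 1 else 0))
      (80 * A.length + 40) := by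
  induction A generalizing B with
  | nil =>
    unfold Computes
    rw [fn_prog (b := eqLB) rfl]
    cases B <;> simp [eqLB, comp, rest]
  | cons x A ih =>
    unfold Computes
    rw [fn_prog (b := eqLB) rfl]
    cases B with
    | nil =>
      simp [eqLB, comp, rest]
    | cons y B =>
      obtain ⟨t, ht, h⟩ := ih B
      obtain ⟨s, hs, h'⟩ := computes_eq_vertex x y
      by_cases hxy : x = y
      · subst hxy
        simp only [if_true] at h'
        simp [eqLB, comp, rest, h', h]
        omega
      · simp only [if_neg hxy] at h'
        simp [eqLB, comp, rest, h', hxy]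
        omega

/-- A pair of a number and another object as a value. -/
def encK {α : Type*} (f : α → Val) (p : ℚ × α) : Val := .pair (.num p.1) (f p.2)

/-- The two cases are those that the callers distinguish by `isPair`: the value `0` means that there
is no candidate. -/
theorem computes_argmin {α : Type*} (f : α → Val) (l : List (ℚ × α)) :
    (l = [] ∧ Computes 6 (encL (encK f) l) (.num 0) 10) ∨
    ∃ p ∈ l, (∀ q ∈ l, p.1 ≤ q.1) ∧
      Computes 6 (encL (encK f) l) (encK f p) (60 * l.length + 10) := by
  induction l with
  | nil =>
    left
    refine ⟨rfl, ?_⟩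
    unfold Computes
    rw [fn_prog (b := argminB) rfl]
    simp [argminB]
  | cons p l ih =>
    right
    unfold Computes
    rw [fn_prog (b := argminB) rfl]
    rcases ih with ⟨rfl, t, ht, h⟩ | ⟨q, hq, hmin, t, ht, h⟩
    · refine ⟨p, by simp, by simp, ?_⟩
      simp only [encL_nil] at h
      simp [argminB, comp, rest, h]
      omega
    · by_cases hpq : p.1 ≤ q.1
      · refine ⟨p, by simp, ?_, ?_⟩
        · intro r hr
          rcases List.mem_cons.1 hr with rfl | hr
          · exact le_rfl
          · exact hpq.trans (hmin r hr)
        · simp [argminB, comp, rest, h, encK, hpq]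
          omega
      · refine ⟨q, by simp [hq], ?_, ?_⟩
        · intro r hr
          rcases List.mem_cons.1 hr with rfl | hr
          · exact (not_le.1 hpq).le
          · exact hmin r hr
        · simp [argminB, comp, rest, h, encK, hpq]
          omega

theorem computes_dbl (q : ℕ) (x : ℚ) :
    Computes 7 (.pair (unary q) (.num x)) (.num (2 ^ q * x)) (40 * q + 20) := by
  induction q generalizing x with
  | zero =>
    unfold Computes
    rw [fn_prog (b := dblB) rfl]
    simp [dblB, comp, rest, unary]
  | succ q ih =>
    obtain ⟨t, ht, h⟩ := ih (x + x)
    unfold Computes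
    rw [fn_prog (b := dblB) rfl]
    rw [show 2 ^ q * (x + x) = 2 ^ (q + 1) * x by ring] at h
    simp [dblB, comp, rest, unary, h]
    omega

theorem computes_mul (q : ℕ) (x : ℚ) :
    Computes 9 (.pair (unary q) (.num x)) (.num (q * x)) (40 * q + 20) := by
  induction q with
  | zero =>
    unfold Computes
    rw [fn_prog (b := mulB) rfl]
    simp [mulB, comp, rest, unary]
  | succ q ih =>
    obtain ⟨t, ht, h⟩ := ih
    unfold Computes
    rw [fn_prog (b := mulB) rfl]
    rw [show ((q + 1 : ℕ) : ℚ) * x = x + q * x by push_cast; ring]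
    simp [mulB, comp, rest, unary, h]
    omega

theorem computes_iota (m : ℕ) (hm : m ≤ n) : ∃ l : List (Fin n), l.Nodup ∧
    (∀ i, i ∈ l ↔ i.1 < m) ∧ l.length = m ∧ Computes 24 (.num m) (encS l) (30 * m + 20) := by
  induction m with
  | zero =>
    refine ⟨[], by simp, by simp, rfl, ?_⟩
    unfold Computes
    rw [fn_prog (b := iotaB) rfl]
    simp [iotaB]
  | succ m ih =>
    obtain ⟨l, hl, hmem, hlen, t, ht, h⟩ := ih (by omega)
    refine ⟨⟨m, hm⟩ :: l, ?_, ?_, by simp [hlen], ?_⟩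
    · simp [hl, hmem]
    · intro i
      simp [hmem, Fin.ext_iff]
      omega
    · unfold Computes
      rw [fn_prog (b := iotaB) rfl]
      have h0 : ¬ ((m : ℚ) + 1 ≤ 0) := by
        have : (0 : ℚ) ≤ m := Nat.cast_nonneg m
        linarith
      simp [iotaB, h, h0, encodeVertex]
      omega

/-- The invariant `2 * N = 2 ^ q.choose 2` survives the passage to `q + 1` because `N` is doubled
`q` times and `(q + 1).choose 2 = q + q.choose 2`. The search starts from `q = 2`, `N = 1`. -/
theorem computes_find (m q N : ℕ) (hq : 1 ≤ q) (hN : 1 ≤ N) (hNm : N ≤ m)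
    (h : 2 * N = 2 ^ q.choose 2) : ∃ r, q ≤ r ∧ 2 ^ r.choose 2 ≤ 2 * m ∧
      2 * m < 2 ^ (r + 1).choose 2 ∧
      Computes 8 (.pair (.num m) (.pair (unary q) (.num N))) (unary r)
        ((40 * r + 100) * (r - q + 1)) := by
  have hc : (q + 1).choose 2 = q + q.choose 2 := by
    rw [Nat.choose_succ_succ]; simp
  obtain ⟨s, hs, h'⟩ := computes_dbl q N
  rw [show (2 ^ q * (N : ℚ)) = ((2 ^ q * N : ℕ) : ℚ) by push_cast; ring] at h'
  have h2 : 2 * (2 ^ q * N) = 2 ^ (q + 1).choose 2 := by rw [hc, pow_add, ← h]; ring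
  by_cases hm : 2 ^ q * N ≤ m
  · have hlt : m - 2 ^ q * N < m - N := by
      have : 2 ^ 1 * N ≤ 2 ^ q * N := Nat.mul_le_mul_right _ (Nat.pow_le_pow_right (by simp) hq)
      omega
    obtain ⟨r, hr1, hr2, hr3, t, ht, h''⟩ := computes_find m (q + 1) (2 ^ q * N) (by omega)
      (Nat.mul_pos (by positivity) hN) hm h2
    refine ⟨r, by omega, hr2, hr3, ?_⟩
    unfold Computes
    rw [fn_prog (b := findB) rfl]
    have hm' : ((2 ^ q * N : ℕ) : ℚ) ≤ m := by exact_mod_cast hm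
    rw [unary] at h''
    generalize ((2 ^ q * N : ℕ) : ℚ) = M at *
    simp [findB, comp, rest, h', h'', hm']
    have e : r - q + 1 = (r - (q + 1) + 1) + 1 := by omega
    rw [e, mul_add, mul_one]
    omega
  · refine ⟨q, le_rfl, by omega, by omega, ?_⟩
    unfold Computes
    rw [fn_prog (b := findB) rfl]
    have hm' : ¬ ((2 ^ q * N : ℕ) : ℚ) ≤ m := by exact_mod_cast hm
    generalize ((2 ^ q * N : ℕ) : ℚ) = M at *
    simp [findB, comp, rest, h', hm']
    omega
termination_by m - N

/-! ### The table of edges and their sides -/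

/-- An edge with its cost as a value. -/
def encE (x : Fin n × Fin n × ℚ) : Val :=
  .pair (encodeVertex x.1) (.pair (encodeVertex x.2.1) (.num x.2.2))

theorem encodeEdges_eq (L : List (Fin n × Fin n × ℚ)) : encodeEdges L = encL encE L := by
  induction L with
  | nil => rfl
  | cons x L ih => rw [encodeEdges, ih]; rfl

/-- The list of edges without `(u, v)`. -/
def without (L : List (Fin n × Fin n × ℚ)) (u v : Fin n) : List (Fin n × Fin n × ℚ) :=
  L.filter fun x => ¬ (x.1 = u ∧ x.2.1 = v)

theorem length_without_le (L : List (Fin n × Fin n × ℚ)) (u v : Fin n) :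
    (without L u v).length ≤ L.length := List.length_filter_le _ _

theorem computes_without (L : List (Fin n × Fin n × ℚ)) (u v : Fin n) :
    Computes 10 (.pair (encL encE L) (.pair (encodeVertex u) (encodeVertex v)))
      (encL encE (without L u v)) (120 * L.length + 20) := by
  induction L with
  | nil =>
    unfold Computes
    rw [fn_prog (b := withoutB) rfl]
    simp [withoutB, comp, rest, without]
  | cons x L ih =>
    obtain ⟨t, ht, h⟩ := ih
    obtain ⟨s, hs, h1⟩ := computes_eq_vertex x.1 u
    obtain ⟨s', hs', h2⟩ := computes_eq_vertex x.2.1 v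
    unfold Computes
    rw [fn_prog (b := withoutB) rfl]
    by_cases hu : x.1 = u
    · by_cases hv : x.2.1 = v
      · simp only [hu, hv, if_true] at h1 h2
        simp only [without] at h ⊢
        simp [withoutB, comp, rest, h, encE, h1, h2, hu, hv] at *
        omega
      · simp only [hu, hv, if_true, if_false] at h1 h2
        simp only [without] at h ⊢
        simp [withoutB, comp, rest, h, encE, h1, h2, hu, hv] at *
        omega
    · simp only [hu, if_false] at h1
      simp only [without] at h ⊢
      simp [withoutB, comp, rest, h, encE, h1, hu] at *
      omega

/-- One round of adding neighbours. -/
def growL : List (Fin n × Fin n × ℚ) → List (Fin n) → List (Fin n)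
  | [], S => S
  | x :: L, S => growL L (if x.1 ∈ S ∨ x.2.1 ∈ S then x.1 :: x.2.1 :: S else S)

theorem length_growL_le (L : List (Fin n × Fin n × ℚ)) (S : List (Fin n)) :
    (growL L S).length ≤ S.length + 2 * L.length := by
  induction L generalizing S with
  | nil => simp [growL]
  | cons x L ih =>
    refine (ih _).trans ?_
    split_ifs <;> grind

/-- The number `s` bounds all intermediate lists, which makes the cost of the membership tests
uniform along the recursion. -/
theorem computes_grow (L : List (Fin n × Fin n × ℚ)) (S : List (Fin n)) (s : ℕ)
    (hs : S.length + 2 * L.length ≤ s) :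
    Computes 11 (.pair (encL encE L) (encS S)) (encS (growL L S))
      ((120 * s + 200) * L.length + 20) := by
  induction L generalizing S with
  | nil =>
    unfold Computes
    rw [fn_prog (b := growB) rfl]
    simp [growB, comp, rest, growL]
  | cons x L ih =>
    obtain ⟨s1, hs1, h1⟩ := computes_mem x.1 S
    obtain ⟨s2, hs2, h2⟩ := computes_mem x.2.1 S
    have hl : ∀ S' : List (Fin n), S'.length ≤ S.length + 2 → S'.length + 2 * L.length ≤ s := by
      intro S' h
      simp only [List.length_cons] at hs
      omega
    rw [List.length_cons, mul_add, mul_one]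
    unfold Computes
    rw [fn_prog (b := growB) rfl]
    by_cases hx : x.1 ∈ S
    · obtain ⟨t, ht, h⟩ := ih (x.1 :: x.2.1 :: S) (hl _ (by simp))
      simp only [hx, if_true] at h1
      simp only [encL_cons] at h
      simp [growB, comp, rest, growL, encE, hx, h1, h]
      omega
    · simp only [hx, if_false] at h1
      by_cases hy : x.2.1 ∈ S
      · obtain ⟨t, ht, h⟩ := ih (x.1 :: x.2.1 :: S) (hl _ (by simp))
        simp only [hy, if_true] at h2
        simp only [encL_cons] at h
        simp [growB, comp, rest, growL, encE, hx, hy, h1, h2, h]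
        omega
      · obtain ⟨t, ht, h⟩ := ih S (hl _ (by simp))
        simp only [hy, if_false] at h2
        simp [growB, comp, rest, growL, encE, hx, hy, h1, h2, h]
        omega

theorem computes_rounds {α : Type*} (f : α → Val) (K : List α) (L : List (Fin n × Fin n × ℚ))
    (S : List (Fin n)) (s : ℕ) (hs : S.length + 2 * L.length * K.length ≤ s) :
    Computes 12 (.pair (encL f K) (.pair (encL encE L) (encS S)))
      (encS ((growL L)^[K.length] S)) (((120 * s + 200) * L.length + 60) * K.length + 20) := by
  induction K generalizing S with
  | nil =>
    unfold Computes
    rw [fn_prog (b := roundsB) rfl]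
    simp [roundsB, comp, rest]
  | cons x K ih =>
    rw [List.length_cons, mul_add, mul_one] at hs
    obtain ⟨t, ht, h⟩ := ih (growL L S) (by have := length_growL_le L S; omega)
    obtain ⟨t', ht', h'⟩ := computes_grow L S s (by omega)
    rw [List.length_cons, mul_add, mul_one]
    unfold Computes
    rw [fn_prog (b := roundsB) rfl]
    simp [roundsB, comp, rest, h, h']
    omega

/-- A directed edge `(u, v)`, its cost, and the vertices on the side of `u`. -/
structure EdgeRec (n : ℕ) where
  /-- first endpoint -/
  u : Fin n
  /-- second endpoint -/
  v : Fin n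
  /-- cost -/
  c : ℚ
  /-- side of the first endpoint -/
  S : List (Fin n)

/-- An edge record as a value. -/
def encR (e : EdgeRec n) : Val :=
  .pair (.pair (encodeVertex e.u) (encodeVertex e.v)) (.pair (.num e.c) (encS e.S))

/-- The records of the edges in `L`, in the tree with list of edges `M`. -/
def tableL (M : List (Fin n × Fin n × ℚ)) (k : ℕ) :
    List (Fin n × Fin n × ℚ) → List (EdgeRec n)
  | [] => []
  | x :: L => ⟨x.1, x.2.1, x.2.2, (growL (without M x.1 x.2.1))^[k] [x.1]⟩ ::
      ⟨x.2.1, x.1, x.2.2, (growL (without M x.1 x.2.1))^[k] [x.2.1]⟩ :: tableL M k L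

theorem computes_table {α : Type*} (f : α → Val) (K : List α) (M L : List (Fin n × Fin n × ℚ))
    (s : ℕ) (hs : 1 + 2 * M.length * K.length ≤ s) :
    Computes 13 (.pair (encL encE L) (.pair (encL encE M) (encL f K)))
      (encL encR (tableL M K.length L))
      ((120 * M.length + 2 * (((120 * s + 200) * M.length + 60) * K.length) + 300) * L.length
        + 20) := by
  induction L with
  | nil =>
    unfold Computes
    rw [fn_prog (b := tableB) rfl]
    simp [tableB, comp, rest, tableL]
  | cons x L ih =>
    obtain ⟨t, ht, h⟩ := ih
    obtain ⟨t0, ht0, h0⟩ := computes_without M x.1 x.2.1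
    have hw := length_without_le M x.1 x.2.1
    have hw' : (without M x.1 x.2.1).length * K.length ≤ M.length * K.length :=
      Nat.mul_le_mul_right _ hw
    have hw2 : ((120 * s + 200) * (without M x.1 x.2.1).length + 60) * K.length ≤
        ((120 * s + 200) * M.length + 60) * K.length := by gcongr
    have hr : ∀ y, _ := fun y => computes_rounds f K (without M x.1 x.2.1) [y] s
      (by rw [mul_assoc] at hs ⊢; simp; omega)
    obtain ⟨t1, ht1, h1⟩ := hr x.1
    obtain ⟨t2, ht2, h2⟩ := hr x.2.1
    simp only [encL_cons, encL_nil] at h1 h2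
    rw [List.length_cons, mul_add _ L.length, mul_one]
    unfold Computes
    rw [fn_prog (b := tableB) rfl]
    simp [tableB, comp, rest, tableL, encE, encR, h, h0, h1, h2]
    omega

/-! ### The sides of the edges of a tree -/

section Sides

variable {V : Type*} {T : SimpleGraph V} {u v w x y : V}

theorem onSide_self (T : SimpleGraph V) (u v : V) : OnSide T u v u := SimpleGraph.Reachable.refl _

theorem not_onSide_of_adj (hT : T.IsTree) (h : T.Adj u v) : ¬ OnSide T u v v := by
  have hb := SimpleGraph.isAcyclic_iff_forall_adj_isBridge.1 hT.isAcyclic h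
  rw [SimpleGraph.isBridge_iff] at hb
  exact hb

theorem deleteEdges_adj_of_ne (h : T.Adj x y) (hne : s(x, y) ≠ s(u, v)) :
    (T.deleteEdges {s(u, v)}).Adj x y := by
  rw [SimpleGraph.deleteEdges_adj]
  exact ⟨h, hne⟩

/-- Follow a walk from `u` to `x`: an edge other than `{u, v}` does not change the side, and
crossing `{u, v}` leads to `u` or `v`, whose sides are known. -/
theorem onSide_or_onSide (hT : T.IsTree) (u v x : V) : OnSide T u v x ∨ OnSide T v u x := by
  obtain ⟨p⟩ := hT.connected.preconnected x u
  induction p with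
  | nil => exact Or.inl (onSide_self T _ v)
  | @cons a b u hab p ih =>
    by_cases hne : s(b, a) = s(u, v)
    · rw [Sym2.eq_iff] at hne
      rcases hne with ⟨rfl, rfl⟩ | ⟨rfl, rfl⟩
      · exact Or.inr (onSide_self T _ _)
      · exact Or.inl (onSide_self T _ _)
    · rcases ih with h | h
      · exact Or.inl (h.trans (deleteEdges_adj_of_ne hab.symm hne).reachable)
      · refine Or.inr (h.trans (deleteEdges_adj_of_ne hab.symm ?_).reachable)
        rwa [Sym2.eq_swap (a := v)]

theorem onSide_swap (hT : T.IsTree) (h : T.Adj u v) : OnSide T v u x ↔ ¬ OnSide T u v x := by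
  constructor
  · intro h1 h2
    refine not_onSide_of_adj hT h (SimpleGraph.Reachable.trans h2 ?_)
    unfold OnSide at h1
    rw [Sym2.eq_swap] at h1
    exact h1.symm
  · intro h1
    exact (onSide_or_onSide hT u v x).resolve_left h1

/-- Every other vertex lies on the side of some neighbour. -/
theorem exists_adj_onSide (hT : T.IsTree) (h : x ≠ u) : ∃ w, T.Adj w u ∧ OnSide T w u x := by
  obtain ⟨p, hp, -⟩ := hT.existsUnique_path u x
  cases p with
  | nil => exact absurd rfl h
  | @cons _ w _ hw p =>
    rw [SimpleGraph.Walk.cons_isPath_iff] at hp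
    -- The rest of the path does not return to `u`, so it avoids the edge `{w, u}`.
    refine ⟨w, hw.symm, ⟨p.toDeleteEdge s(w, u) ?_⟩⟩
    exact fun hmem => hp.2 (p.snd_mem_support_of_mem_edges hmem)

/-- The side of a neighbour `w` is contained in the other sides of its edges. -/
theorem OnSide.of_adj (hT : T.IsTree) (hw : T.Adj w u) (hwv : w ≠ v)
    (h : OnSide T w u x) : OnSide T u v x := by
  -- The side of `w` does not contain `u`, so none of the edges within it is `{u, v}`.
  have key : ∀ y z, OnSide T w u y → (T.deleteEdges {s(w, u)}).Adj y z →
      (T.deleteEdges {s(u, v)}).Adj y z := by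
    intro y z hy hyz
    rw [SimpleGraph.deleteEdges_adj] at hyz
    refine deleteEdges_adj_of_ne hyz.1 ?_
    have hz : OnSide T w u z :=
      SimpleGraph.Reachable.trans hy (deleteEdges_adj_of_ne hyz.1 hyz.2).reachable
    intro he
    rw [Sym2.eq_iff] at he
    rcases he with ⟨rfl, rfl⟩ | ⟨rfl, rfl⟩
    · exact not_onSide_of_adj hT hw hy
    · exact not_onSide_of_adj hT hw hz
  have main : ∀ a b, (T.deleteEdges {s(w, u)}).Walk a b → OnSide T w u a →
      (T.deleteEdges {s(u, v)}).Reachable a b := by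
    intro a b p
    induction p with
    | nil => exact fun _ => SimpleGraph.Reachable.refl _
    | cons hab p ih =>
      exact fun ha => (key _ _ ha hab).reachable.trans
        (ih (SimpleGraph.Reachable.trans ha hab.reachable))
  obtain ⟨p⟩ := h
  refine SimpleGraph.Reachable.trans ?_ (main _ _ p (onSide_self T w u))
  refine (deleteEdges_adj_of_ne hw.symm ?_).reachable
  intro he
  rw [Sym2.eq_iff] at he
  rcases he with ⟨_, rfl⟩ | ⟨rfl, rfl⟩
  · exact hwv rfl
  · exact hw.ne rfl

/-- An edge that separates two vertices on one side of another edge lies on this side. -/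
theorem OnSide.of_split {p q a b : V} (ha : OnSide T p q a) (hb : OnSide T p q b)
    (hau : OnSide T u v a) (hbu : ¬ OnSide T u v b) (hv : ¬ OnSide T u v v) : OnSide T p q u := by
  -- A walk from `a` to `b` that avoids `{p, q}` has to leave the side of `u` through the edge `{u,
  -- v}`, and it does so at `u`.
  obtain ⟨w⟩ := SimpleGraph.Reachable.trans ha.symm hb
  induction w with
  | nil => exact absurd hau hbu
  | @cons a a' b haa w ih =>
    have ha' : OnSide T p q a' := SimpleGraph.Reachable.trans ha haa.reachable
    by_cases h : OnSide T u v a'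
    · exact ih ha' hb h hbu
    · have hT : T.Adj a a' := by
        rw [SimpleGraph.deleteEdges_adj] at haa
        exact haa.1
      by_cases he : s(a, a') = s(u, v)
      · rw [Sym2.eq_iff] at he
        rcases he with ⟨rfl, rfl⟩ | ⟨rfl, rfl⟩
        · exact ha
        · exact absurd hau hv
      · exact absurd (SimpleGraph.Reachable.trans hau (deleteEdges_adj_of_ne hT he).reachable) h

/-- Adjacent vertices are separated by their own edge only. -/
theorem onSide_iff_of_adj (h : T.Adj x w) (hne : s(x, w) ≠ s(u, v)) :
    OnSide T u v x ↔ OnSide T u v w :=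
  ⟨fun hx => SimpleGraph.Reachable.trans hx (deleteEdges_adj_of_ne h hne).reachable,
    fun hw => SimpleGraph.Reachable.trans hw (deleteEdges_adj_of_ne h hne).symm.reachable⟩

end Sides

/-! ### Correctness of the table -/

/-- `E` lists every edge of `T` in both orientations, with its cost and the side of its first
endpoint. -/
structure IsTable (T : SimpleGraph (Fin n)) (c : Sym2 (Fin n) → ℚ) (E : List (EdgeRec n)) :
    Prop where
  adj : ∀ e ∈ E, T.Adj e.u e.v
  cost_eq : ∀ e ∈ E, e.c = c s(e.u, e.v)
  mem_side : ∀ e ∈ E, ∀ x, x ∈ e.S ↔ OnSide T e.u e.v x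
  exists_rec : ∀ u v, T.Adj u v → ∃ e ∈ E, e.u = u ∧ e.v = v
  nodup : (E.map fun e => (e.u, e.v)).Nodup

theorem subset_growL (M : List (Fin n × Fin n × ℚ)) (S : List (Fin n)) : S ⊆ growL M S := by
  induction M generalizing S with
  | nil => exact List.Subset.refl _
  | cons x M ih =>
    refine List.Subset.trans ?_ (ih _)
    split_ifs
    · exact fun a ha => by simp [ha]
    · exact List.Subset.refl _

theorem mem_growL {M : List (Fin n × Fin n × ℚ)} {S : List (Fin n)} {y : Fin n × Fin n × ℚ}
    (hy : y ∈ M) (h : y.1 ∈ S ∨ y.2.1 ∈ S) : y.1 ∈ growL M S ∧ y.2.1 ∈ growL M S := by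
  induction M generalizing S with
  | nil => simp at hy
  | cons x M ih =>
    rw [growL]
    rcases List.mem_cons.1 hy with rfl | hy
    · rw [if_pos h]
      exact ⟨subset_growL _ _ (by simp), subset_growL _ _ (by simp)⟩
    · refine ih hy ?_
      split_ifs
      · exact h.imp (fun h => by simp [h]) (fun h => by simp [h])
      · exact h

theorem growL_sound {G : SimpleGraph (Fin n)} {M : List (Fin n × Fin n × ℚ)} {S : List (Fin n)}
    {r : Fin n} (hM : ∀ y ∈ M, G.Adj y.1 y.2.1) (hS : ∀ x ∈ S, G.Reachable r x) :
    ∀ x ∈ growL M S, G.Reachable r x := by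
  induction M generalizing S with
  | nil => exact hS
  | cons y M ih =>
    refine ih (fun z hz => hM z (by simp [hz])) ?_
    have hy := hM y (by simp)
    split_ifs with h
    · intro x hx
      simp only [List.mem_cons] at hx
      rcases hx with rfl | rfl | hx
      · rcases h with h | h
        · exact hS _ h
        · exact (hS _ h).trans hy.symm.reachable
      · rcases h with h | h
        · exact (hS _ h).trans hy.reachable
        · exact hS _ h
      · exact hS x hx
    · exact hS

theorem iterate_growL_sound {G : SimpleGraph (Fin n)} {M : List (Fin n × Fin n × ℚ)}
    {S : List (Fin n)} {r : Fin n} (hM : ∀ y ∈ M, G.Adj y.1 y.2.1)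
    (hS : ∀ x ∈ S, G.Reachable r x) (k : ℕ) : ∀ x ∈ (growL M)^[k] S, G.Reachable r x := by
  induction k generalizing S with
  | zero => exact hS
  | succ k ih => exact ih (growL_sound hM hS)

/-- Every round adds at least the next vertex of the walk. -/
theorem iterate_growL_complete {G : SimpleGraph (Fin n)} {M : List (Fin n × Fin n × ℚ)}
    (hM : ∀ a b, G.Adj a b → ∃ y ∈ M, s(y.1, y.2.1) = s(a, b)) {a b : Fin n} (p : G.Walk a b) :
    ∀ (S : List (Fin n)) (k : ℕ), a ∈ S → p.length ≤ k → b ∈ (growL M)^[k] S := by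
  induction p with
  | nil =>
    intro S k ha _
    induction k generalizing S with
    | zero => exact ha
    | succ k ih => exact ih (growL M S) (subset_growL _ _ ha) (Nat.zero_le _)
  | @cons a a' b h p ih =>
    intro S k ha hk
    obtain ⟨k, rfl⟩ : ∃ k', k = k' + 1 := ⟨k - 1, by simp at hk; omega⟩
    refine ih _ k ?_ (by simpa using hk)
    obtain ⟨y, hy, he⟩ := hM a a' h
    rw [Sym2.eq_iff] at he
    rcases he with ⟨h1, h2⟩ | ⟨h1, h2⟩
    · exact h2 ▸ (mem_growL hy (Or.inl (h1 ▸ ha))).2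
    · exact h1 ▸ (mem_growL hy (Or.inr (h2 ▸ ha))).1

theorem mem_iterate_growL {G : SimpleGraph (Fin n)} {M : List (Fin n × Fin n × ℚ)}
    (hM : ∀ a b, (∃ y ∈ M, s(y.1, y.2.1) = s(a, b)) ↔ G.Adj a b) (r x : Fin n) :
    x ∈ (growL M)^[n] [r] ↔ G.Reachable r x := by
  constructor
  · refine iterate_growL_sound (fun y hy => (hM _ _).1 ⟨y, hy, rfl⟩) ?_ n x
    simp
  · rintro ⟨p⟩
    classical
    -- A path has fewer than `n` edges, so `n` rounds are enough.
    refine iterate_growL_complete (fun a b h => (hM a b).2 h) p.toPath.1 _ _ (by simp) ?_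
    have := p.toPath.2.length_lt
    rw [Fintype.card_fin] at this
    exact this.le

variable {T : SimpleGraph (Fin n)} {c : Sym2 (Fin n) → ℚ} {L : List (Fin n × Fin n × ℚ)}

/-- Every edge is listed only once, so removing its entry in the stored orientation removes the
edge. -/
theorem ListsEdges.without_iff (hL : ListsEdges T c L) {x : Fin n × Fin n × ℚ} (hx : x ∈ L)
    (a b : Fin n) : (∃ y ∈ without L x.1 x.2.1, s(y.1, y.2.1) = s(a, b)) ↔
      (T.deleteEdges {s(x.1, x.2.1)}).Adj a b := by
  obtain ⟨hnd, hmem, -⟩ := hL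
  have hinj := List.inj_on_of_nodup_map hnd
  have hadj := hmem s(a, b)
  rw [SimpleGraph.mem_edgeSet] at hadj
  rw [SimpleGraph.deleteEdges_adj, ← hadj]
  simp only [without, List.mem_filter, decide_eq_true_eq, List.mem_map]
  constructor
  · rintro ⟨y, ⟨hy, hne⟩, he⟩
    refine ⟨⟨y, hy, he⟩, ?_⟩
    rw [Set.mem_singleton_iff, ← he]
    intro h
    rw [hinj hy hx h] at hne
    exact hne ⟨rfl, rfl⟩
  · rintro ⟨⟨y, hy, he⟩, hne⟩
    refine ⟨y, ⟨hy, ?_⟩, he⟩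
    rintro ⟨h1, h2⟩
    rw [Set.mem_singleton_iff, ← he, h1, h2] at hne
    exact hne rfl

theorem mem_tableL {M L : List (Fin n × Fin n × ℚ)} {k : ℕ} {e : EdgeRec n} :
    e ∈ tableL M k L ↔ ∃ x ∈ L,
      e = ⟨x.1, x.2.1, x.2.2, (growL (without M x.1 x.2.1))^[k] [x.1]⟩ ∨
      e = ⟨x.2.1, x.1, x.2.2, (growL (without M x.1 x.2.1))^[k] [x.2.1]⟩ := by
  induction L with
  | nil => simp [tableL]
  | cons x L ih => simp [tableL, ih, or_assoc]

theorem length_tableL (M L : List (Fin n × Fin n × ℚ)) (k : ℕ) :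
    (tableL M k L).length = 2 * L.length := by
  induction L with
  | nil => rfl
  | cons x L ih => simp [tableL, ih]; omega

theorem length_iterate_growL_le (M : List (Fin n × Fin n × ℚ)) (S : List (Fin n)) (k : ℕ) :
    ((growL M)^[k] S).length ≤ S.length + 2 * M.length * k := by
  induction k generalizing S with
  | zero => simp
  | succ k ih =>
    have := ih (growL M S)
    have := length_growL_le M S
    rw [Function.iterate_succ_apply, mul_add]
    omega

/-- Sides are lists with repetitions, since `growL` adds endpoints again and again; `n` would not be
a valid bound. -/
theorem length_side_le {M L : List (Fin n × Fin n × ℚ)} {k : ℕ} {e : EdgeRec n}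
    (he : e ∈ tableL M k L) : e.S.length ≤ 1 + 2 * M.length * k := by
  obtain ⟨x, -, h⟩ := mem_tableL.1 he
  have hw : 2 * (without M x.1 x.2.1).length * k ≤ 2 * M.length * k := by
    have := length_without_le M x.1 x.2.1
    gcongr
  rcases h with rfl | rfl <;>
  · refine (length_iterate_growL_le _ _ _).trans ?_
    simpa using hw

theorem nodup_tableL {M L : List (Fin n × Fin n × ℚ)} {k : ℕ}
    (hnd : (L.map fun x => s(x.1, x.2.1)).Nodup) (hne : ∀ x ∈ L, x.1 ≠ x.2.1) :
    ((tableL M k L).map fun e => (e.u, e.v)).Nodup := by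
  induction L with
  | nil => simp [tableL]
  | cons x L ih =>
    rw [List.map_cons, List.nodup_cons] at hnd
    have hx := hne x (by simp)
    have key : ∀ e ∈ tableL M k L, s(e.u, e.v) ≠ s(x.1, x.2.1) := by
      intro e he h
      obtain ⟨y, hy, h'⟩ := mem_tableL.1 he
      refine hnd.1 (List.mem_map.2 ⟨y, hy, ?_⟩)
      rw [← h]
      rcases h' with rfl | rfl
      · rfl
      · exact Sym2.eq_swap
    simp only [tableL, List.map_cons, List.nodup_cons, List.mem_cons, List.mem_map, Prod.mk.injEq,
      not_or, not_exists, not_and]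
    refine ⟨⟨fun h _ => hx h, fun e he h1 h2 => key e he (by rw [h1, h2])⟩,
      fun e he h1 h2 => key e he (by rw [h1, h2, Sym2.eq_swap]), ih hnd.2 fun y hy => hne y ?_⟩
    simp [hy]

theorem isTable_tableL (hL : ListsEdges T c L) : IsTable T c (tableL L n L) := by
  have hadj : ∀ x ∈ L, T.Adj x.1 x.2.1 := fun x hx =>
    (hL.2.1 s(x.1, x.2.1)).1 (List.mem_map.2 ⟨x, hx, rfl⟩)
  refine ⟨?_, ?_, ?_, ?_, nodup_tableL hL.1 fun x hx => (hadj x hx).ne⟩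
  · intro e he
    obtain ⟨x, hx, rfl | rfl⟩ := mem_tableL.1 he
    · exact hadj x hx
    · exact (hadj x hx).symm
  · intro e he
    obtain ⟨x, hx, rfl | rfl⟩ := mem_tableL.1 he
    · exact hL.2.2 x hx
    · rw [hL.2.2 x hx, Sym2.eq_swap]
  · intro e he y
    obtain ⟨x, hx, rfl | rfl⟩ := mem_tableL.1 he
    · exact mem_iterate_growL (hL.without_iff hx) _ _
    · unfold OnSide
      rw [Sym2.eq_swap]
      exact mem_iterate_growL (hL.without_iff hx) _ _
  · intro u v h
    obtain ⟨x, hx, he⟩ := List.mem_map.1 ((hL.2.1 s(u, v)).2 h)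
    rw [Sym2.eq_iff] at he
    rcases he with ⟨h1, h2⟩ | ⟨h1, h2⟩
    · exact ⟨_, mem_tableL.2 ⟨x, hx, Or.inl rfl⟩, h1, h2⟩
    · exact ⟨_, mem_tableL.2 ⟨x, hx, Or.inr rfl⟩, h2, h1⟩

theorem ListsEdges.length_add_one (hL : ListsEdges T c L) (hT : T.IsTree) : L.length + 1 = n := by
  classical
  have h := hT.card_edgeFinset
  rw [Fintype.card_fin] at h
  have h' := List.toFinset_card_of_nodup hL.1
  rw [List.length_map] at h'
  rw [← h']
  refine Eq.trans (congrArg (fun s => Finset.card s + 1) ?_) h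
  ext e
  rw [List.mem_toFinset, hL.2.1, SimpleGraph.mem_edgeFinset]

/-! ### Separators -/

variable {E : List (EdgeRec n)}

/-- Both endpoints of every edge that splits `A` belong to `A`. -/
def SplitClosed (T : SimpleGraph (Fin n)) (A : List (Fin n)) : Prop :=
  ∀ u v, T.Adj u v → (∃ a ∈ A, OnSide T u v a) → (∃ b ∈ A, ¬ OnSide T u v b) → u ∈ A ∧ v ∈ A

/-- Apply `OnSide.of_split` to the splitting edge in both orientations. -/
theorem SplitClosed.of_onSide (hT : T.IsTree) {A B : List (Fin n)} (hA : SplitClosed T A)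
    {p q : Fin n} (hB : ∀ x, x ∈ B ↔ x ∈ A ∧ OnSide T p q x) : SplitClosed T B := by
  rintro u v huv ⟨a, ha, hau⟩ ⟨b, hb, hbu⟩
  rw [hB] at ha hb
  obtain ⟨hu, hv⟩ := hA u v huv ⟨a, ha.1, hau⟩ ⟨b, hb.1, hbu⟩
  rw [hB, hB]
  refine ⟨⟨hu, ha.2.of_split hb.2 hau hbu (not_onSide_of_adj hT huv)⟩, hv,
    hb.2.of_split ha.2 ((onSide_swap hT huv).2 hbu) ?_ (not_onSide_of_adj hT huv.symm)⟩
  rw [onSide_swap hT huv, not_not]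
  exact hau

theorem SplitClosed.inter_side (hT : T.IsTree) (hE : IsTable T c E) {A : List (Fin n)}
    (hA : SplitClosed T A) {e : EdgeRec n} (he : e ∈ E) :
    SplitClosed T (inter A e.S) :=
  hA.of_onSide hT (p := e.u) (q := e.v) fun x => by simp [hE.mem_side e he]

theorem SplitClosed.diff_side (hT : T.IsTree) (hE : IsTable T c E) {A : List (Fin n)}
    (hA : SplitClosed T A) {e : EdgeRec n} (he : e ∈ E) :
    SplitClosed T (diff A e.S) :=
  hA.of_onSide hT (p := e.v) (q := e.u) fun x => by
    simp [hE.mem_side e he, onSide_swap hT (hE.adj e he)]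

/-- A set that avoids `x` lies on the side of one neighbour. -/
theorem SplitClosed.exists_side (hT : T.IsTree) {H : List (Fin n)} (hH : SplitClosed T H)
    {x h : Fin n} (hh : h ∈ H) (hx : x ∉ H) :
    ∃ w, T.Adj w x ∧ ∀ y ∈ H, OnSide T w x y := by
  obtain ⟨w, hw, hwh⟩ := exists_adj_onSide hT (ne_of_mem_of_not_mem hh hx)
  refine ⟨w, hw, fun y hy => ?_⟩
  by_contra hne
  -- Otherwise the edge `{w, x}` splits `H`, and then `x` would belong to `H`.
  exact hx (hH w x hw ⟨h, hh, hwh⟩ ⟨y, hy, hne⟩).2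

/-- The candidates for the next element of a separator of `R`. -/
def sepCandsL (R : List (Fin n)) (m q : ℕ) (E : List (EdgeRec n)) : List (ℚ × EdgeRec n) :=
  (E.filter fun e => e.u ∈ R ∧ m ≤ q * (inter R e.S).length).map
    fun e => (((inter R e.S).length : ℚ), e)

theorem computes_sepCands (R : List (Fin n)) (m q : ℕ) {s : ℕ} (hs : ∀ e ∈ E, e.S.length ≤ s) :
    Computes 14 (.pair (encL encR E) (.pair (encS R) (.pair (.num m) (unary q))))
      (encL (encK encR) (sepCandsL R m q E))
      (((60 * s + 60) * R.length + 80 * R.length + 40 * q + 200) * E.length + 20) := by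
  induction E with
  | nil =>
    unfold Computes
    rw [fn_prog (b := sepCandsB) rfl]
    simp [sepCandsB, comp, rest, sepCandsL]
  | cons e E ih =>
    obtain ⟨t, ht, h⟩ := ih fun e' he' => hs e' (by simp [he'])
    obtain ⟨t1, ht1, h1⟩ := computes_inter R e.S
    obtain ⟨t2, ht2, h2⟩ := computes_len encodeVertex (inter R e.S)
    obtain ⟨t3, ht3, h3⟩ := computes_mem e.u R
    obtain ⟨t4, ht4, h4⟩ := computes_mul q ((inter R e.S).length : ℚ)
    have hlen : (inter R e.S).length ≤ R.length := List.length_filter_le _ _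
    have hS : (60 * e.S.length + 60) * R.length ≤ (60 * s + 60) * R.length := by
      have := hs e (by simp)
      gcongr
    rw [List.length_cons, mul_add _ E.length, mul_one]
    unfold Computes
    rw [fn_prog (b := sepCandsB) rfl]
    by_cases hu : e.u ∈ R
    · simp only [hu, if_true] at h3
      by_cases hm : m ≤ q * (inter R e.S).length
      · have hm' : (m : ℚ) ≤ q * (inter R e.S).length := by exact_mod_cast hm
        rw [show sepCandsL R m q (e :: E) = (((inter R e.S).length : ℚ), e) ::
          sepCandsL R m q E by
            rw [sepCandsL, List.filter_cons_of_pos (by simp [hu, hm])]; rfl]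
        simp [sepCandsB, comp, rest, encR, encK, eS, eU, h, h1, h2, h3, h4, hm']
        omega
      · have hm' : ¬ (m : ℚ) ≤ q * (inter R e.S).length := by exact_mod_cast hm
        rw [show sepCandsL R m q (e :: E) = sepCandsL R m q E by
          rw [sepCandsL, List.filter_cons_of_neg (by simp [hm])]; rfl]
        simp [sepCandsB, comp, rest, encR, eS, eU, h, h1, h2, h3, h4, hm']
        omega
    · simp only [hu, if_false] at h3
      rw [show sepCandsL R m q (e :: E) = sepCandsL R m q E by
        rw [sepCandsL, List.filter_cons_of_neg (by simp [hu])]; rfl]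
      simp [sepCandsB, comp, rest, encR, eS, eU, h, h1, h2, h3]
      omega

theorem mem_sepCandsL {R : List (Fin n)} {m q : ℕ} {p : ℚ × EdgeRec n} :
    p ∈ sepCandsL R m q E ↔ p.2 ∈ E ∧ p.2.u ∈ R ∧ m ≤ q * (inter R p.2.S).length ∧
      p.1 = ((inter R p.2.S).length : ℚ) := by
  obtain ⟨k, e⟩ := p
  simp only [sepCandsL, List.mem_map, List.mem_filter, decide_eq_true_eq, Prod.mk.injEq]
  constructor
  · rintro ⟨e', ⟨h1, h2, h3⟩, rfl, rfl⟩
    exact ⟨h1, h2, h3, rfl⟩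
  · rintro ⟨h1, h2, h3, h4⟩
    exact ⟨e, ⟨h1, h2, h3⟩, h4.symm, rfl⟩

theorem length_sepCandsL_le (R : List (Fin n)) (m q : ℕ) :
    (sepCandsL R m q E).length ≤ E.length := by
  rw [sepCandsL, List.length_map]
  exact List.length_filter_le _ _

theorem length_le_of_subset {A B : List (Fin n)} (hA : A.Nodup) (h : A ⊆ B) :
    A.length ≤ B.length := (List.subperm_of_subset hA h).length_le

/-- The pieces on the sides of the neighbours of `x` are smaller than `m / q` if no candidate is
left, or if `x` comes from the best candidate. -/
theorem SplitClosed.mul_length_lt (hT : T.IsTree) (hE : IsTable T c E) {R H : List (Fin n)}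
    (hR : SplitClosed T R) {m q : ℕ} (hm : 1 ≤ m) (hH : SplitClosed T H) (hHnd : H.Nodup)
    (hHR : H ⊆ R) {x : Fin n} (hxR : x ∈ R) (hxH : x ∉ H)
    (hsmall : ∀ e ∈ E, e.u ∈ R → e.v = x → (∃ h ∈ H, h ∈ e.S) →
      q * (inter R e.S).length < m) : q * H.length < m := by
  rcases H with - | ⟨h, H'⟩
  · simp only [List.length_nil, mul_zero]; omega
  obtain ⟨w, hw, hside⟩ := hH.exists_side hT (h := h) (by simp) hxH
  obtain ⟨e, he, rfl, rfl⟩ := hE.exists_rec _ _ hw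
  -- The edge from `w` to `x` splits `R`, with `h` on one side and `x` on the other.
  have hwR : e.u ∈ R := (hR _ _ hw ⟨h, hHR (by simp), hside h (by simp)⟩
    ⟨_, hxR, not_onSide_of_adj hT hw⟩).1
  have hsub : (h :: H') ⊆ inter R e.S := by
    intro y hy
    exact mem_inter.2 ⟨hHR hy, (hE.mem_side e he y).2 (hside y hy)⟩
  refine lt_of_le_of_lt (Nat.mul_le_mul_left q (length_le_of_subset hHnd hsub))
    (hsmall e he hwR rfl ⟨h, by simp, (hE.mem_side e he h).2 (hside h (by simp))⟩)

/-- Greedy choice: among the directed edges from a vertex `u ∈ R` with `m ≤ q * |R ∩ S|`, where `S`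
is the side of `u`, take one with `|R ∩ S|` minimal, put `u` into `X` and discard `S`. When there is
no such edge left, any single remaining vertex completes `X`; it accounts for the summand `m` in the
bound on `|X|`. -/
theorem computes_sep (hT : T.IsTree) (hE : IsTable T c E) {s r q m : ℕ}
    (hs : ∀ e ∈ E, e.S.length ≤ s) (hm : 1 ≤ m) (R : List (Fin n)) (hr : R.length ≤ r)
    (hnd : R.Nodup) (hR : SplitClosed T R) :
    ∃ X : List (Fin n), X.Nodup ∧ X ⊆ R ∧ (R ≠ [] → X ≠ []) ∧
      m * X.length ≤ q * R.length + m ∧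
      (∀ H : List (Fin n), H.Nodup → SplitClosed T H → H ⊆ R → (∀ x ∈ X, x ∉ H) →
        q * H.length < m) ∧
      Computes 15 (.pair (encS R) (.pair (.num m) (.pair (unary q) (encL encR E)))) (encS X)
        ((((60 * s + 60) * r + 80 * r + 40 * q + 300) * E.length + (60 * s + 60) * r + 200) *
          (R.length + 1)) := by
  induction hk : R.length using Nat.strong_induction_on generalizing R with
  | _ k ih =>
  obtain ⟨t1, ht1, h1⟩ := computes_sepCands R m q hs
  have hb : ((60 * s + 60) * R.length + 80 * R.length + 40 * q + 200) * E.length ≤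
      ((60 * s + 60) * r + 80 * r + 40 * q + 200) * E.length := by gcongr
  have hb' : (60 * s + 60) * R.length ≤ (60 * s + 60) * r := by gcongr
  have hb2 : ((60 * s + 60) * r + 80 * r + 40 * q + 300) * E.length =
      ((60 * s + 60) * r + 80 * r + 40 * q + 200) * E.length + 100 * E.length := by ring
  rw [hb2]
  have hlen := length_sepCandsL_le (E := E) R m q
  rcases computes_argmin encR (sepCandsL R m q E) with ⟨hnil, t2, ht2, h2⟩ | ⟨p, hp, hmin, t2, ht2, h2⟩
  · have hno : ∀ e ∈ E, e.u ∈ R → q * (inter R e.S).length < m := by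
      intro e he hu
      by_contra hcon
      have := (mem_sepCandsL (E := E) (p := (((inter R e.S).length : ℚ), e))).2 ⟨he, hu, not_lt.1 hcon, rfl⟩
      rw [hnil] at this
      simp at this
    rcases R with - | ⟨a, R⟩
    · refine ⟨[], by simp, by simp, by simp, by simp, ?_, ?_⟩
      · intro H _ _ hH _
        rw [List.subset_nil.1 hH]
        simp only [List.length_nil, mul_zero]; omega
      · unfold Computes
        rw [fn_prog (b := sepB) rfl]
        simp only [encL_nil] at h1 h2
        simp [sepB, comp, rest, h1, h2] at *
        rw [← hk]
        omega
    · refine ⟨[a], by simp, by simp, by simp, by simp, ?_, ?_⟩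
      · intro H hH1 hH2 hH3 hH4
        exact hR.mul_length_lt hT hE hm hH2 hH1 hH3 (x := a) (by simp) (hH4 a (by simp))
          fun e he hu _ _ => hno e he hu
      · unfold Computes
        rw [fn_prog (b := sepB) rfl]
        rw [mul_add, mul_one]
        simp only [encL_cons] at h1
        simp [sepB, comp, rest, h1, h2] at *
        omega
  · obtain ⟨hpE, hpu, hpm, hp1⟩ := mem_sepCandsL.1 hp
    obtain ⟨key, e⟩ := p
    simp only at hpE hpu hpm hp1
    have hue : e.u ∈ e.S := (hE.mem_side e hpE _).2 (onSide_self T _ _)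
    have hadd := length_inter_add R e.S
    have hpos : 0 < (inter R e.S).length :=
      List.length_pos_of_mem (mem_inter.2 ⟨hpu, hue⟩)
    obtain ⟨X, hX1, hX2, -, hX4, hX5, t3, ht3, h3⟩ := ih _ (by omega)
      (diff R e.S) (by omega) (nodup_diff hnd _) (hR.diff_side hT hE hpE) rfl
    obtain ⟨t4, ht4, h4⟩ := computes_diff R e.S
    have hS : (60 * e.S.length + 60) * R.length ≤ (60 * s + 60) * R.length := by
      have := hs e hpE
      gcongr
    refine ⟨e.u :: X, ?_, ?_, by simp, ?_, ?_, ?_⟩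
    · refine List.nodup_cons.2 ⟨fun h => (mem_diff.1 (hX2 h)).2 hue, hX1⟩
    · intro x hx
      rcases List.mem_cons.1 hx with rfl | hx
      · exact hpu
      · exact (mem_diff.1 (hX2 hx)).1
    -- The new element adds `m` on the left, and by `hpm` the discarded vertices add at least `m` on
    -- the right.
    · rw [List.length_cons, ← hk, ← hadd, mul_add, mul_add, mul_one]
      omega
    · intro H hH1 hH2 hH3 hH4
      have huH := hH4 e.u (by simp)
      by_cases hside : ∃ h ∈ H, h ∈ e.S
      · have hall : ∀ y ∈ H, y ∈ e.S := by
          intro y hy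
          by_contra hne
          obtain ⟨h, hh, hhS⟩ := hside
          rw [hE.mem_side e hpE] at hne hhS
          exact huH (hH2 e.u e.v (hE.adj e hpE) ⟨h, hh, hhS⟩ ⟨y, hy, hne⟩).1
        -- Here `H` lies within the side of `u` and avoids `u`, so it is contained in the side of a
        -- neighbour of `u` other than `e.v`. That side meets `R` in fewer vertices, since `u` is
        -- missing; by minimality it is not large.
        refine hR.mul_length_lt hT hE hm hH2 hH1 hH3 hpu huH ?_
        rintro e' he' hu' hv' ⟨h, hh, hhS⟩
        by_contra hcon
        have hle := hmin _ ((mem_sepCandsL (E := E) (p := (((inter R e'.S).length : ℚ), e'))).2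
          ⟨he', hu', not_lt.1 hcon, rfl⟩)
        rw [hp1, Nat.cast_le] at hle
        have hadj := hE.adj e' he'
        rw [hv'] at hadj
        have hne : e'.u ≠ e.v := by
          intro h'
          have h1 := (hE.mem_side e' he' h).1 hhS
          have h2 := (hE.mem_side e hpE h).1 (hall h hh)
          rw [h', hv', onSide_swap hT (hE.adj e hpE)] at h1
          exact h1 h2
        have hsub : e.u :: inter R e'.S ⊆ inter R e.S := by
          intro y hy
          rcases List.mem_cons.1 hy with rfl | hy
          · exact mem_inter.2 ⟨hpu, hue⟩
          · rw [mem_inter] at hy ⊢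
            refine ⟨hy.1, (hE.mem_side e hpE y).2 ?_⟩
            have := (hE.mem_side e' he' y).1 hy.2
            rw [hv'] at this
            exact OnSide.of_adj hT hadj hne this
        have hnot : e.u ∉ inter R e'.S := by
          intro hmem
          have := (hE.mem_side e' he' _).1 (mem_inter.1 hmem).2
          rw [hv'] at this
          exact not_onSide_of_adj hT hadj this
        have := length_le_of_subset (List.nodup_cons.2 ⟨hnot, nodup_inter hnd _⟩) hsub
        simp only [List.length_cons] at this
        omega
      · refine hX5 H hH1 hH2 ?_ fun x hx => hH4 x (by simp [hx])
        intro y hy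
        exact mem_diff.2 ⟨hH3 hy, fun h => hside ⟨y, hy, h⟩⟩
    · unfold Computes
      rw [fn_prog (b := sepB) rfl]
      rw [← hk]
      have hmul : (((60 * s + 60) * r + 80 * r + 40 * q + 200) * E.length + 100 * E.length +
          (60 * s + 60) * r + 200) * ((diff R e.S).length + 1 + 1) ≤
          (((60 * s + 60) * r + 80 * r + 40 * q + 200) * E.length + 100 * E.length +
          (60 * s + 60) * r + 200) * (R.length + 1) := by
        gcongr
        omega
      rw [hb2] at ht3
      refine ⟨_, ?_, by simp [sepB, comp, rest, encR, encK, eS, eU, h1, h2, h3, h4]; rfl⟩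
      refine le_trans ?_ hmul
      rw [mul_add _ (_ + 1) 1, mul_one]
      omega

/-! ### Best strategies for few vertices -/

/-- The sublists of a list. -/
def subsL : List (Fin n) → List (List (Fin n))
  | [] => [[]]
  | x :: X => (subsL X).map (x :: ·) ++ subsL X

theorem length_subsL (X : List (Fin n)) : (subsL X).length = 2 ^ X.length := by
  induction X with
  | nil => rfl
  | cons x X ih => simp [subsL, ih, pow_succ]; omega

/-- Running through the sublists of `X` therefore covers every split of `X` by an edge. -/
theorem inter_mem_subsL (X S : List (Fin n)) : inter X S ∈ subsL X := by
  induction X with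
  | nil => simp [inter, subsL]
  | cons x X ih =>
    by_cases hx : x ∈ S
    · rw [show inter (x :: X) S = x :: inter X S by simp [inter, hx]]
      simp [subsL, ih]
    · rw [show inter (x :: X) S = inter X S by simp [inter, hx]]
      simp [subsL, ih]

theorem computes_consAll (x : Fin n) (l m : List (List (Fin n))) :
    Computes 16 (.pair (encodeVertex x) (.pair (encL encS l) (encL encS m)))
      (encL encS (l.map (x :: ·) ++ m)) (40 * l.length + 20) := by
  induction l with
  | nil =>
    unfold Computes
    rw [fn_prog (b := consAllB) rfl]
    simp [consAllB, comp, rest]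
  | cons y l ih =>
    obtain ⟨t, ht, h⟩ := ih
    unfold Computes
    rw [fn_prog (b := consAllB) rfl]
    simp [consAllB, comp, rest, h]
    omega

theorem computes_subs (X : List (Fin n)) :
    Computes 17 (encS X) (encL encS (subsL X)) (100 * 2 ^ X.length) := by
  induction X with
  | nil =>
    unfold Computes
    rw [fn_prog (b := subsB) rfl]
    simp [subsB, subsL]
  | cons x X ih =>
    obtain ⟨t, ht, h⟩ := ih
    obtain ⟨t', ht', h'⟩ := computes_consAll x (subsL X) (subsL X)
    have hpos := Nat.one_le_two_pow (n := X.length)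
    rw [length_subsL] at ht'
    unfold Computes
    rw [fn_prog (b := subsB) rfl]
    simp [subsB, comp, rest, subsL, h, h', pow_succ]
    omega

/-- The records of the edges that split off `Y` from `X`, together with their costs. -/
def splitCandsL (X Y : List (Fin n)) (E : List (EdgeRec n)) : List (ℚ × EdgeRec n) :=
  (E.filter fun e => inter X e.S = Y).map fun e => (e.c, e)

theorem mem_splitCandsL {X Y : List (Fin n)} {p : ℚ × EdgeRec n} :
    p ∈ splitCandsL X Y E ↔ p.2 ∈ E ∧ inter X p.2.S = Y ∧ p.1 = p.2.c := by
  obtain ⟨k, e⟩ := p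
  simp only [splitCandsL, List.mem_map, List.mem_filter, decide_eq_true_eq, Prod.mk.injEq]
  constructor
  · rintro ⟨e', ⟨h1, h2⟩, rfl, rfl⟩
    exact ⟨h1, h2, rfl⟩
  · rintro ⟨h1, h2, h3⟩
    exact ⟨e, ⟨h1, h2⟩, h3.symm, rfl⟩

theorem length_splitCandsL_le (X Y : List (Fin n)) : (splitCandsL X Y E).length ≤ E.length := by
  rw [splitCandsL, List.length_map]
  exact List.length_filter_le _ _

theorem computes_splitCands (X Y : List (Fin n)) {s : ℕ} (hs : ∀ e ∈ E, e.S.length ≤ s) :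
    Computes 18 (.pair (encL encR E) (.pair (encS X) (encS Y)))
      (encL (encK encR) (splitCandsL X Y E))
      (((60 * s + 60) * X.length + 80 * X.length + 200) * E.length + 20) := by
  induction E with
  | nil =>
    unfold Computes
    rw [fn_prog (b := splitCandsB) rfl]
    simp [splitCandsB, comp, rest, splitCandsL]
  | cons e E ih =>
    obtain ⟨t, ht, h⟩ := ih fun e' he' => hs e' (by simp [he'])
    obtain ⟨t1, ht1, h1⟩ := computes_inter X e.S
    obtain ⟨t2, ht2, h2⟩ := computes_eqL (inter X e.S) Y
    have hlen := length_inter_add X e.S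
    have hS : (60 * e.S.length + 60) * X.length ≤ (60 * s + 60) * X.length := by
      have := hs e (by simp)
      gcongr
    rw [List.length_cons, mul_add _ E.length, mul_one]
    unfold Computes
    rw [fn_prog (b := splitCandsB) rfl]
    by_cases hY : inter X e.S = Y
    · simp only [hY, if_true] at h1 h2
      rw [show splitCandsL X Y (e :: E) = (e.c, e) :: splitCandsL X Y E by
        rw [splitCandsL, List.filter_cons_of_pos (by simp [hY])]; rfl]
      simp [splitCandsB, comp, rest, encR, encK, eS, eC, h, h1, h2]
      omega
    · simp only [hY, if_false] at h2
      rw [show splitCandsL X Y (e :: E) = splitCandsL X Y E by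
        rw [splitCandsL, List.filter_cons_of_neg (by simp [hY])]; rfl]
      simp [splitCandsB, comp, rest, encR, eS, h, h1, h2]
      omega

/-- A search strategy that asks for recorded edges. -/
inductive Skel (n : ℕ) where
  | leaf (x : Fin n) : Skel n
  | node (e : EdgeRec n) (l r : Skel n) : Skel n

/-- A strategy as a value. -/
def encSk : Skel n → Val
  | .leaf x => encodeVertex x
  | .node e l r => .pair (encR e) (.pair (encSk l) (encSk r))

/-- The strategy tells the elements of `X` apart with total cost at most `v`. -/
def Skel.IsFor (E : List (EdgeRec n)) : Skel n → List (Fin n) → ℚ → Prop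
  | .leaf x, X, v => X = [x] ∧ 0 ≤ v
  | .node e l r, X, v => e ∈ E ∧ inter X e.S ≠ [] ∧ diff X e.S ≠ [] ∧
      l.IsFor E (inter X e.S) (v - e.c) ∧ r.IsFor E (diff X e.S) (v - e.c)

theorem Skel.IsFor.mono {K : Skel n} {X : List (Fin n)} {v w : ℚ} (h : K.IsFor E X v)
    (hvw : v ≤ w) : K.IsFor E X w := by
  induction K generalizing X v w with
  | leaf x => exact ⟨h.1, h.2.trans hvw⟩
  | node e l r ihl ihr =>
    obtain ⟨h1, h2, h3, h4, h5⟩ := h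
    exact ⟨h1, h2, h3, ihl h4 (by linarith), ihr h5 (by linarith)⟩

/-- Every strategy that identifies the elements of `X` has cost at least `v` for one of them. -/
def LowerBound (T : SimpleGraph (Fin n)) (c : Sym2 (Fin n) → ℚ) (X : List (Fin n)) (v : ℚ) :
    Prop :=
  ∀ D : DecTree (Fin n), D.QueriesEdges T → (∀ x ∈ X, D.search T x = x) →
    ∃ x ∈ X, v ≤ D.costAt T c x

theorem costAt_nonneg (hc : ∀ e ∈ T.edgeSet, 0 ≤ c e) {D : DecTree (Fin n)}
    (hD : D.QueriesEdges T) (x : Fin n) : 0 ≤ D.costAt T c x := by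
  induction D with
  | leaf => exact le_rfl
  | node u v l r ihl ihr =>
    obtain ⟨h1, h2, h3⟩ := hD
    have := hc s(u, v) h1
    have := ihl h2
    have := ihr h3
    rw [DecTree.costAt]
    split_ifs <;> linarith

/-- Queries of `D` that do not split `X` only add nonnegative cost, and no leaf can serve both `a`
and `b`. So some query splits `X`; it costs `e.c`, and the harder of the two parts still has to be
solved. -/
theorem lowerBound_of_splits (hE : IsTable T c E) (hc : ∀ e ∈ T.edgeSet, 0 ≤ c e)
    {X : List (Fin n)} {a b : Fin n} (ha : a ∈ X) (hb : b ∈ X) (hab : a ≠ b) {v : ℚ}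
    (h : ∀ e ∈ E, inter X e.S ≠ [] → diff X e.S ≠ [] → ∃ v1 v2,
      LowerBound T c (inter X e.S) v1 ∧ LowerBound T c (diff X e.S) v2 ∧ v ≤ e.c + max v1 v2) :
    LowerBound T c X v := by
  intro D hD hs
  induction D with
  | leaf y =>
    exact absurd ((hs a ha).symm.trans (hs b hb)) hab
  | node p q l r ihl ihr =>
    obtain ⟨h1, h2, h3⟩ := hD
    obtain ⟨e, he, rfl, rfl⟩ := hE.exists_rec _ _ h1
    have hc0 := hc s(e.u, e.v) h1
    have hside := hE.mem_side e he
    simp only [DecTree.search] at hs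
    by_cases hi : inter X e.S = []
    · have hout : ∀ x ∈ X, ¬ OnSide T e.u e.v x := by
        intro x hx hmem
        have : x ∈ inter X e.S := mem_inter.2 ⟨hx, (hside x).2 hmem⟩
        simp [hi] at this
      obtain ⟨x, hx, hv⟩ := ihr h3 fun x hx => by simpa [hout x hx] using hs x hx
      refine ⟨x, hx, ?_⟩
      rw [DecTree.costAt, if_neg (hout x hx)]
      linarith
    by_cases hd : diff X e.S = []
    · have hin : ∀ x ∈ X, OnSide T e.u e.v x := by
        intro x hx
        by_contra hmem
        have : x ∈ diff X e.S := mem_diff.2 ⟨hx, fun h => hmem ((hside x).1 h)⟩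
        simp [hd] at this
      obtain ⟨x, hx, hv⟩ := ihl h2 fun x hx => by simpa [hin x hx] using hs x hx
      refine ⟨x, hx, ?_⟩
      rw [DecTree.costAt, if_pos (hin x hx)]
      linarith
    obtain ⟨v1, v2, hv1, hv2, hv⟩ := h e he hi hd
    rw [hE.cost_eq e he] at hv
    rcases max_choice v1 v2 with hm | hm
    · obtain ⟨x, hx, hxv⟩ := hv1 l h2 fun x hx => by
        obtain ⟨hx, hxS⟩ := mem_inter.1 hx
        simpa [(hside x).1 hxS] using hs x hx
      obtain ⟨hx, hxS⟩ := mem_inter.1 hx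
      refine ⟨x, hx, ?_⟩
      rw [DecTree.costAt, if_pos ((hside x).1 hxS)]
      linarith
    · obtain ⟨x, hx, hxv⟩ := hv2 r h3 fun x hx => by
        obtain ⟨hx, hxS⟩ := mem_diff.1 hx
        rw [hside] at hxS
        simpa [hxS] using hs x hx
      obtain ⟨hx, hxS⟩ := mem_diff.1 hx
      rw [hside] at hxS
      refine ⟨x, hx, ?_⟩
      rw [DecTree.costAt, if_neg hxS]
      linarith

/-- There is a strategy for `X` of optimal cost that the program finds within `B` steps. -/
def FindsBest (T : SimpleGraph (Fin n)) (c : Sym2 (Fin n) → ℚ) (E : List (EdgeRec n))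
    (X : List (Fin n)) (B : ℕ) : Prop :=
  ∃ v K, Skel.IsFor E K X v ∧ LowerBound T c X v ∧
    Computes 20 (.pair (encS X) (encL encR E)) (.pair (.num v) (encSk K)) B

/-- Edges with the same trace on `X` leave the same two subproblems, so only the cheapest of them
matters. -/
theorem diff_eq_of_inter_eq {X S S' : List (Fin n)} (h : inter X S = inter X S') :
    diff X S = diff X S' := by
  refine List.filter_congr fun x hx => ?_
  have : x ∈ inter X S ↔ x ∈ inter X S' := by rw [h]
  simp only [mem_inter, hx, true_and] at this
  simp [this]

/-- Execution of the one branch that produces a strategy. The lists are arbitrary values, and the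
pairs `y, Y` and `z, Z` express that both parts are nonempty. The number `k` occurs twice, as key of
the candidate and as cost in its record. -/
theorem fn_bestAll_cons {y Y Ys X E l w S z Z K1 K2 C : Val} {k v1 v2 : ℚ}
    {t t1 t2 t3 t4 t5 : ℕ}
    (h : fn prog 19 (.pair Ys (.pair X E)) = some (l, t))
    (h1 : fn prog 18 (.pair E (.pair X (.pair y Y))) = some (C, t1))
    (h2 : fn prog 6 C = some (.pair (.num k) (.pair w (.pair (.num k) S)), t2))
    (h3 : fn prog 3 (.pair X S) = some (.pair z Z, t3))
    (h4 : fn prog 20 (.pair (.pair y Y) E) = some (.pair (.num v1) K1, t4))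
    (h5 : fn prog 20 (.pair (.pair z Z) E) = some (.pair (.num v2) K2, t5)) :
    Computes 19 (.pair (.pair (.pair y Y) Ys) (.pair X E))
      (.pair (.pair (.num (k + max v1 v2))
        (.pair (.pair w (.pair (.num k) S)) (.pair K1 K2))) l)
      (t + t1 + t2 + t3 + t4 + t5 + 200) := by
  unfold Computes
  rw [fn_prog (b := bestAllB) rfl]
  rcases le_total v1 v2 with hle | hle
  · simp [bestAllB, comp, rest, eS, h, h1, h2, h3, h4, h5, hle]
    omega
  · by_cases hle' : v1 ≤ v2
    · simp [bestAllB, comp, rest, eS, h, h1, h2, h3, h4, h5, hle']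
      omega
    · simp [bestAllB, comp, rest, eS, h, h1, h2, h3, h4, h5, hle, hle']
      omega

theorem computes_bestAll {s B : ℕ} (hs : ∀ e ∈ E, e.S.length ≤ s) (X : List (Fin n))
    (hX : X.Nodup) (hB : ∀ X' : List (Fin n), X'.Nodup → X' ≠ [] → X'.length < X.length →
      FindsBest T c E X' B) (Ys : List (List (Fin n))) :
    ∃ l : List (ℚ × Skel n), (∀ p ∈ l, p.2.IsFor E X p.1) ∧
      (∀ e ∈ E, inter X e.S ∈ Ys → inter X e.S ≠ [] → diff X e.S ≠ [] → ∃ p ∈ l, ∃ v1 v2,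
        LowerBound T c (inter X e.S) v1 ∧ LowerBound T c (diff X e.S) v2 ∧
          p.1 ≤ e.c + max v1 v2) ∧
      l.length ≤ Ys.length ∧
      Computes 19 (.pair (encL encS Ys) (.pair (encS X) (encL encR E))) (encL (encK encSk) l)
        ((((60 * s + 60) * X.length + 80 * X.length + 300) * E.length +
          (60 * s + 60) * X.length + 2 * B + 300) * Ys.length + 20) := by
  induction Ys with
  | nil =>
    refine ⟨[], by simp, by simp, by simp, ?_⟩
    unfold Computes
    rw [fn_prog (b := bestAllB) rfl]
    simp [bestAllB, comp, rest]
  | cons Y Ys ih =>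
    obtain ⟨l, hl1, hl2, hl3, t, ht, h⟩ := ih
    obtain ⟨t1, ht1, h1⟩ := computes_splitCands (E := E) X Y hs
    have hlen := length_splitCandsL_le (E := E) X Y
    rw [show (((60 * s + 60) * X.length + 80 * X.length + 300) * E.length +
        (60 * s + 60) * X.length + 2 * B + 300) * (Y :: Ys).length =
      (((60 * s + 60) * X.length + 80 * X.length + 300) * E.length +
        (60 * s + 60) * X.length + 2 * B + 300) * Ys.length +
      (((60 * s + 60) * X.length + 80 * X.length + 200) * E.length + 100 * E.length +
        (60 * s + 60) * X.length + 2 * B + 300) by rw [List.length_cons]; ring]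
    rcases computes_argmin encR (splitCandsL X Y E) with
      ⟨hnil, t2, ht2, h2⟩ | ⟨⟨k, e⟩, hp, hmin, t2, ht2, h2⟩
    · refine ⟨l, hl1, ?_, by simp; omega, ?_⟩
      · intro e he hmem hi hd
        rcases List.mem_cons.1 hmem with hY | hmem
        · have := (mem_splitCandsL (E := E) (p := (e.c, e))).2 ⟨he, hY, rfl⟩
          simp [hnil] at this
        · exact hl2 e he hmem hi hd
      · unfold Computes
        rw [fn_prog (b := bestAllB) rfl]
        simp [bestAllB, comp, rest, h, h1, h2]
        omega
    obtain ⟨he, hY, hk⟩ := mem_splitCandsL.1 hp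
    simp only at he hY hk
    obtain ⟨t3, ht3, h3⟩ := computes_diff X e.S
    have hS : (60 * e.S.length + 60) * X.length ≤ (60 * s + 60) * X.length := by
      have := hs e he
      gcongr
    have hadd := length_inter_add X e.S
    have hdiff : ∀ e' : EdgeRec n, inter X e'.S = Y → diff X e'.S = diff X e.S := fun e' h' =>
      diff_eq_of_inter_eq (h'.trans hY.symm)
    by_cases hYnil : Y = []
    · refine ⟨l, hl1, ?_, by simp; omega, ?_⟩
      · intro e' he' hmem hi hd
        rcases List.mem_cons.1 hmem with hY' | hmem
        · exact absurd (hY'.trans hYnil) hi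
        · exact hl2 e' he' hmem hi hd
      · subst hYnil
        simp only [encL_nil] at h1
        unfold Computes
        rw [fn_prog (b := bestAllB) rfl]
        simp [bestAllB, comp, rest, encK, encR, eS, h, h1, h2, h3]
        omega
    obtain ⟨y, Y', hYc⟩ := List.exists_cons_of_ne_nil hYnil
    by_cases hdnil : diff X e.S = []
    · refine ⟨l, hl1, ?_, by simp; omega, ?_⟩
      · intro e' he' hmem hi hd
        rcases List.mem_cons.1 hmem with hY' | hmem
        · exact absurd ((hdiff e' hY').trans hdnil) hd
        · exact hl2 e' he' hmem hi hd
      · rw [hdnil] at h3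
        subst hYc
        simp only [encL_cons, encL_nil] at h1 h3
        unfold Computes
        rw [fn_prog (b := bestAllB) rfl]
        simp [bestAllB, comp, rest, encK, encR, eS, h, h1, h2, h3]
        omega
    obtain ⟨z, Z, hZ⟩ := List.exists_cons_of_ne_nil hdnil
    have hYlen : 0 < Y.length := List.length_pos_of_ne_nil hYnil
    have hZlen : 0 < (diff X e.S).length := List.length_pos_of_ne_nil hdnil
    rw [hY] at hadd
    obtain ⟨v1, K1, hK1, hv1, t4, ht4, h4⟩ := hB Y (hY ▸ nodup_inter hX e.S) hYnil (by omega)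
    obtain ⟨v2, K2, hK2, hv2, t5, ht5, h5⟩ := hB _ (nodup_diff hX e.S) hdnil (by omega)
    refine ⟨(e.c + max v1 v2, .node e K1 K2) :: l, ?_, ?_, by simp; omega, ?_⟩
    · intro p hp
      rcases List.mem_cons.1 hp with rfl | hp
      · refine ⟨he, by rwa [hY], hdnil, ?_, ?_⟩
        · rw [hY]
          exact hK1.mono (by simp)
        · exact hK2.mono (by simp)
      · exact hl1 p hp
    · intro e' he' hmem hi hd
      rcases List.mem_cons.1 hmem with hY' | hmem
      · refine ⟨_, List.mem_cons_self, v1, v2, by rwa [hY'], by rwa [hdiff e' hY'], ?_⟩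
        have := hmin _ ((mem_splitCandsL (E := E) (p := (e'.c, e'))).2 ⟨he', hY', rfl⟩)
        simp only at this ⊢
        rw [hk] at this
        linarith
      · obtain ⟨p, hp, hp'⟩ := hl2 e' he' hmem hi hd
        exact ⟨p, List.mem_cons_of_mem _ hp, hp'⟩
    · rw [hZ] at h3 h5
      subst hYc
      subst hk
      simp only [encL_cons] at h1 h3 h4 h5
      exact (fn_bestAll_cons h h1 h2 h3 h4 h5).mono (by omega)

/-- The recurrence for the time of `findsBest`: work `M` and two recursive calls for each of the `2
^ m` sublists. The exponent grows by `2 * m + 1` from `m - 1` to `m`, and `m + 2` would do. -/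
theorem best_time_bound {M B' m : ℕ} (hm : 1 ≤ m)
    (hB : B' = M * 2 ^ ((m - 1) ^ 2 + 2 * (m - 1))) :
    2 ^ m * (M + 2 * B') ≤ M * 2 ^ (m ^ 2 + 2 * m) := by
  have h1 : M ≤ B' := by
    rw [hB]
    exact Nat.le_mul_of_pos_right _ (by positivity)
  have h2 : m + 2 + ((m - 1) ^ 2 + 2 * (m - 1)) ≤ m ^ 2 + 2 * m := by
    obtain ⟨k, rfl⟩ : ∃ k, m = k + 1 := ⟨m - 1, by omega⟩
    simp only [Nat.add_sub_cancel]
    nlinarith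
  calc 2 ^ m * (M + 2 * B') ≤ 2 ^ m * (4 * B') := by gcongr; omega
    _ = M * 2 ^ (m + 2 + ((m - 1) ^ 2 + 2 * (m - 1))) := by rw [hB, pow_add, pow_add]; ring
    _ ≤ M * 2 ^ (m ^ 2 + 2 * m) := by gcongr; omega

theorem findsBest (hT : T.IsTree) (hE : IsTable T c E) (hc : ∀ e ∈ T.edgeSet, 0 ≤ c e) {s r : ℕ}
    (hs : ∀ e ∈ E, e.S.length ≤ s) (X : List (Fin n)) (hX : X.Nodup) (hne : X ≠ [])
    (hr : X.length ≤ r) :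
    FindsBest T c E X ((((60 * s + 60) * r + 80 * r + 300) * E.length + (60 * s + 60) * r + 700) *
      2 ^ (X.length ^ 2 + 2 * X.length)) := by
  induction hk : X.length using Nat.strong_induction_on generalizing X with
  | _ k ih =>
  set M := ((60 * s + 60) * r + 80 * r + 300) * E.length + (60 * s + 60) * r + 700 with hM
  match X, hne, hk with
  | [x], _, hk =>
    refine ⟨0, .leaf x, ⟨rfl, le_rfl⟩, ?_, ?_⟩
    · intro D hD _
      exact ⟨x, by simp, costAt_nonneg hc hD x⟩
    · unfold Computes
      rw [fn_prog (b := bestB) rfl]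
      have hpos : 1 ≤ 2 ^ (k ^ 2 + 2 * k) := Nat.one_le_two_pow
      have : M * 1 ≤ M * 2 ^ (k ^ 2 + 2 * k) := by gcongr
      simp [bestB, comp, rest, encSk]
      omega
  | x :: y :: X', _, hk =>
    set X := x :: y :: X' with hXdef
    have hk2 : 2 ≤ k := by rw [← hk, hXdef]; simp
    obtain ⟨l, hl1, hl2, hl3, t, ht, h⟩ := computes_bestAll (T := T) (c := c) (E := E) hs X hX
      (B := M * 2 ^ ((k - 1) ^ 2 + 2 * (k - 1)))
      (fun X' hX' hne' hlt => by
        obtain ⟨v, K, h1, h2, h3⟩ := ih X'.length (by omega) X' hX' hne' (by omega) rfl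
        refine ⟨v, K, h1, h2, h3.mono ?_⟩
        have : X'.length ≤ k - 1 := by omega
        gcongr
        simp) (subsL X)
    have hxy : x ≠ y := by
      rw [hXdef] at hX
      simp at hX
      exact hX.1.1
    -- The edge at `y` towards `x` splits `X`, so the list `l` of strategies is not empty.
    obtain ⟨w, hw, hwx⟩ := exists_adj_onSide hT hxy
    obtain ⟨e, he, rfl, rfl⟩ := hE.exists_rec _ _ hw
    have hxi : x ∈ inter X e.S := mem_inter.2 ⟨by simp [hXdef], (hE.mem_side e he x).2 hwx⟩
    have hyd : e.v ∈ diff X e.S := mem_diff.2 ⟨by simp [hXdef], fun h' =>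
      not_onSide_of_adj hT hw ((hE.mem_side e he e.v).1 h')⟩
    obtain ⟨p0, hp0, -⟩ := hl2 e he (inter_mem_subsL X e.S) (List.ne_nil_of_mem hxi)
      (List.ne_nil_of_mem hyd)
    rcases computes_argmin encSk l with ⟨hnil, -⟩ | ⟨⟨v, K⟩, hp, hmin, t2, ht2, h2⟩
    · simp [hnil] at hp0
    refine ⟨v, K, hl1 _ hp, ?_, ?_⟩
    · refine lowerBound_of_splits hE hc (a := x) (b := e.v) (by simp [hXdef]) (by simp [hXdef]) hxy
        fun e' he' hi hd => ?_
      obtain ⟨p, hp, v1, v2, h1, h2, h3⟩ := hl2 e' he' (inter_mem_subsL X e'.S) hi hd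
      exact ⟨v1, v2, h1, h2, (hmin p hp).trans h3⟩
    · obtain ⟨t3, ht3, h3⟩ := computes_subs X
      rw [length_subsL, hk] at *
      have hpos : 1 ≤ 2 ^ k := Nat.one_le_two_pow
      refine Computes.mono (M := 2 ^ k * (M + 2 * (M * 2 ^ ((k - 1) ^ 2 + 2 * (k - 1))))) ?_
        (best_time_bound (m := k) (by omega) rfl)
      set B := M * 2 ^ ((k - 1) ^ 2 + 2 * (k - 1)) with hBdef
      have hM' : ((60 * s + 60) * k + 80 * k + 300) * E.length + (60 * s + 60) * k + 2 * B + 300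
          + 400 ≤ M + 2 * B := by
        rw [hM]
        have : ((60 * s + 60) * k + 80 * k + 300) * E.length ≤
          ((60 * s + 60) * r + 80 * r + 300) * E.length := by gcongr
        have : (60 * s + 60) * k ≤ (60 * s + 60) * r := by gcongr
        omega
      have hM2 := Nat.mul_le_mul_left (2 ^ k) hM'
      rw [mul_add, mul_comm] at hM2
      simp only [hXdef, encL_cons] at h h3
      unfold Computes
      rw [fn_prog (b := bestB) rfl]
      simp [bestB, comp, rest, hXdef, h, h2, h3, encK]
      omega

/-! ### The recursive search -/

/-- The total cost of the edges in `F` that end in `x`. -/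
def starSum (F : List (EdgeRec n)) (x : Fin n) : ℚ :=
  ((F.filter fun e => e.v = x).map fun e => e.c).sum

theorem starSum_cons_of_eq {e : EdgeRec n} {x : Fin n} (h : e.v = x) (F : List (EdgeRec n)) :
    starSum (e :: F) x = e.c + starSum F x := by
  simp [starSum, h]

theorem starSum_cons_of_ne {e : EdgeRec n} {x : Fin n} (h : e.v ≠ x) (F : List (EdgeRec n)) :
    starSum (e :: F) x = starSum F x := by
  simp [starSum, h]

theorem starSum_nonneg {F : List (EdgeRec n)} (h : ∀ e ∈ F, 0 ≤ e.c) (x : Fin n) :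
    0 ≤ starSum F x := by
  refine List.sum_nonneg ?_
  simp only [List.mem_map, List.mem_filter, forall_exists_index, and_imp]
  rintro q e he - rfl
  exact h e he

/-- `C` is at least as large as the lower bounds on the cost of a decision tree that the
algorithm relies on. -/
structure IsBound (T : SimpleGraph (Fin n)) (c : Sym2 (Fin n) → ℚ) (E : List (EdgeRec n))
    (C : ℚ) : Prop where
  nonneg : 0 ≤ C
  starSum_le : ∀ x, starSum E x ≤ C
  lowerBound_le : ∀ X v, X ≠ [] → LowerBound T c X v → v ≤ C

/-- `D` is a decision tree for the vertices in `A` whose cost is at most `f C` for every bound `C`. -/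
structure Handles (T : SimpleGraph (Fin n)) (c : Sym2 (Fin n) → ℚ) (E : List (EdgeRec n))
    (A : List (Fin n)) (D : DecTree (Fin n)) (f : ℚ → ℚ) : Prop where
  queries : D.QueriesEdges T
  numLeaves_eq : D.numLeaves = A.length
  search_eq : ∀ x ∈ A, D.search T x = x
  cost_le : ∀ C, IsBound T c E C → ∀ x ∈ A, D.costAt T c x ≤ f C

theorem Handles.mono {A : List (Fin n)} {D : DecTree (Fin n)} {f g : ℚ → ℚ}
    (h : Handles T c E A D f) (hfg : ∀ C, IsBound T c E C → f C ≤ g C) : Handles T c E A D g :=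
  ⟨h.queries, h.numLeaves_eq, h.search_eq, fun C hC x hx => (h.cost_le C hC x hx).trans (hfg C hC)⟩

theorem Handles.node (hE : IsTable T c E) {e : EdgeRec n} (he : e ∈ E) {A : List (Fin n)}
    {D₁ D₂ : DecTree (Fin n)} {f g w : ℚ → ℚ} (h₁ : Handles T c E (inter A e.S) D₁ f)
    (h₂ : Handles T c E (diff A e.S) D₂ g) (hf : ∀ C, IsBound T c E C → e.c + f C ≤ w C)
    (hg : ∀ C, IsBound T c E C → e.c + g C ≤ w C) :
    Handles T c E A (.node e.u e.v D₁ D₂) w := by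
  have hside := hE.mem_side e he
  refine ⟨⟨hE.adj e he, h₁.queries, h₂.queries⟩, ?_, ?_, ?_⟩
  · rw [DecTree.numLeaves, h₁.numLeaves_eq, h₂.numLeaves_eq, length_inter_add]
  · intro x hx
    by_cases h : x ∈ e.S
    · rw [DecTree.search, if_pos ((hside x).1 h)]
      exact h₁.search_eq x (mem_inter.2 ⟨hx, h⟩)
    · rw [DecTree.search, if_neg (by rwa [← hside x])]
      exact h₂.search_eq x (mem_diff.2 ⟨hx, h⟩)
  · intro C hC x hx
    by_cases h : x ∈ e.S
    · rw [DecTree.costAt, if_pos ((hside x).1 h), ← hE.cost_eq e he]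
      have := h₁.cost_le C hC x (mem_inter.2 ⟨hx, h⟩)
      have := hf C hC
      linarith
    · rw [DecTree.costAt, if_neg (by rwa [← hside x]), ← hE.cost_eq e he]
      have := h₂.cost_le C hC x (mem_diff.2 ⟨hx, h⟩)
      have := hg C hC
      linarith

/-- The program finds a decision tree for the vertices in `A` with cost at most `k C`
within `P` steps for each of them. -/
def Solves (T : SimpleGraph (Fin n)) (c : Sym2 (Fin n) → ℚ) (E : List (EdgeRec n)) (q : ℕ)
    (A : List (Fin n)) (k P : ℕ) : Prop :=
  ∃ D, Handles T c E A D (fun C => k * C) ∧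
    Computes 23 (.pair (encS A) (.pair (unary q) (encL encR E))) (encodeDecTree D) (P * A.length)

/-- The edges at `x` are queried one by one, until the answer is a piece that avoids `x`; hence at
most `starSum F x` is spent before the recursion. By `hcover`, the records still to come cover all
candidates but `x`, so only `x` is left at the end. Edges without candidates beyond them are
skipped, which keeps the number of leaves equal to `|A|`. -/
theorem computes_star (hT : T.IsTree) (hE : IsTable T c E) (hc : ∀ e ∈ T.edgeSet, 0 ≤ c e)
    {s r q k P : ℕ} (hs : ∀ e ∈ E, e.S.length ≤ s) {x : Fin n} (F : List (EdgeRec n))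
    (hF : ∀ e ∈ F, e ∈ E) (A : List (Fin n)) (hr : A.length ≤ r) (hnd : A.Nodup)
    (hA : SplitClosed T A) (hx : x ∈ A)
    (hcover : ∀ y ∈ A, y ≠ x → ∃ e ∈ F, e.v = x ∧ y ∈ e.S)
    (hsolve : ∀ H : List (Fin n), H.Nodup → H ≠ [] → SplitClosed T H → H ⊆ A → x ∉ H →
      Solves T c E q H k P) :
    ∃ D, Handles T c E A D (fun C => starSum F x + k * C) ∧
      Computes 21 (.pair (encL encR F) (.pair (encodeVertex x) (.pair (encS A)
        (.pair (unary q) (encL encR E))))) (encodeDecTree D)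
        ((2 * ((60 * s + 60) * r) + 300) * F.length + 20 + P * (A.length - 1)) := by
  induction F generalizing A with
  | nil =>
    have hA1 : A = [x] := by
      have hall : ∀ y ∈ A, y = x := fun y hy => by
        by_contra hne
        simpa using hcover y hy hne
      rcases A with - | ⟨a, A⟩
      · simp at hx
      rcases A with - | ⟨b, A⟩
      · rw [hall a (by simp)]
      · rw [hall a (by simp), hall b (by simp)] at hnd
        simp at hnd
    subst hA1
    refine ⟨.leaf x, ⟨trivial, rfl, ?_, ?_⟩, ?_⟩
    · intro y hy
      rw [List.mem_singleton.1 hy]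
      rfl
    · intro C hC y _
      have := hC.nonneg
      simp only [DecTree.costAt, starSum, List.filter_nil, List.map_nil, List.sum_nil, zero_add]
      positivity
    · unfold Computes
      rw [fn_prog (b := starB) rfl]
      simp [starB, comp, rest, encodeDecTree]
  | cons e F ih =>
    have he := hF e (by simp)
    have hside := hE.mem_side e he
    have hF' : ∀ e ∈ F, e ∈ E := fun e he => hF e (by simp [he])
    have hcost : ∀ e ∈ E, 0 ≤ e.c := fun e he => by
      rw [hE.cost_eq e he]
      exact hc _ (hE.adj e he)
    have hsum := starSum_nonneg (fun e he => hcost e (hF' e he)) x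
    obtain ⟨t1, ht1, h1⟩ := computes_inter A e.S
    obtain ⟨t2, ht2, h2⟩ := computes_eq_vertex e.v x
    have hS : (60 * e.S.length + 60) * A.length ≤ (60 * s + 60) * r := by
      have := hs e he
      gcongr
    have hskip : (e.v ≠ x ∨ inter A e.S = []) →
        ∀ y ∈ A, y ≠ x → ∃ e ∈ F, e.v = x ∧ y ∈ e.S := by
      intro h y hy hyx
      obtain ⟨e', he', hv, hyS⟩ := hcover y hy hyx
      rcases List.mem_cons.1 he' with rfl | he'
      · rcases h with h | h
        · exact absurd hv h
        · have : y ∈ inter A e'.S := mem_inter.2 ⟨hy, hyS⟩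
          simp [h] at this
      · exact ⟨e', he', hv, hyS⟩
    rw [List.length_cons, mul_add _ F.length, mul_one]
    by_cases hv : e.v = x
    · rw [if_pos hv] at h2
      by_cases hi : inter A e.S = []
      · obtain ⟨D, hD, t, ht, h⟩ := ih hF' A hr hnd hA hx (hskip (Or.inr hi)) hsolve
        refine ⟨D, hD.mono fun C _ => ?_, ?_⟩
        · rw [starSum_cons_of_eq hv]
          linarith [hcost e he]
        · rw [hi] at h1
          simp only [encL_nil] at h1
          unfold Computes
          rw [fn_prog (b := starB) rfl]
          simp [starB, comp, rest, encR, eS, eV, h, h1, h2]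
          omega
      · have hxS : x ∉ e.S := fun h => by
          rw [hside, ← hv] at h
          exact not_onSide_of_adj hT (hE.adj e he) h
        have hadd := length_inter_add A e.S
        have hdpos : 0 < (diff A e.S).length := List.length_pos_of_mem (mem_diff.2 ⟨hx, hxS⟩)
        obtain ⟨D₂, hD₂, t3, ht3, h3⟩ := ih hF' (diff A e.S) (by omega) (nodup_diff hnd _)
          (hA.diff_side hT hE he) (mem_diff.2 ⟨hx, hxS⟩)
          (fun y hy hyx => by
            obtain ⟨hy, hyS⟩ := mem_diff.1 hy
            obtain ⟨e', he', hv, hyS'⟩ := hcover y hy hyx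
            rcases List.mem_cons.1 he' with rfl | he'
            · exact absurd hyS' hyS
            · exact ⟨e', he', hv, hyS'⟩)
          (fun H h1 h2 h3 h4 h5 => hsolve H h1 h2 h3 (fun y hy => (mem_diff.1 (h4 hy)).1) h5)
        obtain ⟨D₁, hD₁, t4, ht4, h4⟩ := hsolve (inter A e.S) (nodup_inter hnd _) hi
          (hA.inter_side hT hE he) (fun y hy => (mem_inter.1 hy).1)
          (fun h => hxS (mem_inter.1 h).2)
        obtain ⟨t5, ht5, h5⟩ := computes_diff A e.S
        refine ⟨.node e.u e.v D₁ D₂, hD₁.node hE he hD₂ (fun C hC => ?_) (fun C hC => ?_), ?_⟩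
        · rw [starSum_cons_of_eq hv]
          linarith
        · rw [starSum_cons_of_eq hv]
          linarith
        -- The vertex `x` lies in the second part and is not charged there either.
        · have hP : P * (A.length - 1) =
              P * (inter A e.S).length + P * ((diff A e.S).length - 1) := by
            rw [← mul_add]
            congr 1
            omega
          obtain ⟨y, Y, hY⟩ := List.exists_cons_of_ne_nil hi
          rw [hP]
          rw [hY] at h1 h4
          simp only [encL_cons] at h1 h4
          unfold Computes
          rw [fn_prog (b := starB) rfl]
          simp [starB, comp, rest, encR, eS, eV, encodeDecTree, h1, h2, h3, h4, h5]
          omega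
    · rw [if_neg hv] at h2
      obtain ⟨D, hD, t, ht, h⟩ := ih hF' A hr hnd hA hx (hskip (Or.inl hv)) hsolve
      refine ⟨D, hD.mono fun C _ => ?_, ?_⟩
      · rw [starSum_cons_of_ne hv]
      · unfold Computes
        rw [fn_prog (b := starB) rfl]
        simp [starB, comp, rest, encR, eS, eV, h, h1, h2]
        omega

/-- A node of `K` splits `A` and `X` by the same edge. At a leaf one element of `X` is left and
`computes_star` takes over, at cost `C` for the star and `k * C` for the recursion. The elements of
`X` take no part in the recursion, hence the factor `A.length - X.length` of `P`. -/
theorem computes_expand (hT : T.IsTree) (hE : IsTable T c E) (hc : ∀ e ∈ T.edgeSet, 0 ≤ c e)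
    {s r q k P : ℕ} (hs : ∀ e ∈ E, e.S.length ≤ s) (K : Skel n) (X : List (Fin n)) (v : ℚ)
    (hK : K.IsFor E X v) (A : List (Fin n)) (hr : A.length ≤ r) (hnd : A.Nodup)
    (hA : SplitClosed T A) (hXnd : X.Nodup) (hXA : X ⊆ A)
    (hsolve : ∀ H : List (Fin n), H.Nodup → H ≠ [] → SplitClosed T H → H ⊆ A → (∀ x ∈ X, x ∉ H) →
      Solves T c E q H k P) :
    ∃ D, Handles T c E A D (fun C => v + (k + 1) * C) ∧
      Computes 22 (.pair (encSk K) (.pair (encS A) (.pair (unary q) (encL encR E))))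
        (encodeDecTree D)
        (((2 * ((60 * s + 60) * r) + 300) * (E.length + 1)) * (2 * X.length - 1) +
          P * (A.length - X.length)) := by
  induction K generalizing X v A with
  | leaf x =>
    obtain ⟨rfl, hv⟩ := hK
    have hx : x ∈ A := hXA (by simp)
    obtain ⟨D, hD, t, ht, h⟩ := computes_star hT hE hc (P := P) (q := q) (k := k) hs E (fun _ h => h) A
      hr hnd hA hx (fun y _ hyx => by
        obtain ⟨w, hw, hwy⟩ := exists_adj_onSide hT hyx
        obtain ⟨e, he, rfl, rfl⟩ := hE.exists_rec _ _ hw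
        exact ⟨e, he, rfl, (hE.mem_side e he y).2 hwy⟩)
      (fun H h1 h2 h3 h4 h5 => hsolve H h1 h2 h3 h4 (by simpa using h5))
    refine ⟨D, hD.mono fun C hC => ?_, ?_⟩
    · have := hC.starSum_le x
      linarith
    · unfold Computes
      rw [fn_prog (b := expandB) rfl]
      simp [expandB, comp, rest, encSk, encodeVertex] at h ⊢
      simp [h, mul_add]
      omega
  | node e l r' ihl ihr =>
    obtain ⟨he, hi, hd, hl, hr'⟩ := hK
    have haddA := length_inter_add A e.S
    have haddX := length_inter_add X e.S
    have hXi : inter X e.S ⊆ inter A e.S := fun x hx => by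
      rw [mem_inter] at hx ⊢
      exact ⟨hXA hx.1, hx.2⟩
    have hXd : diff X e.S ⊆ diff A e.S := fun x hx => by
      rw [mem_diff] at hx ⊢
      exact ⟨hXA hx.1, hx.2⟩
    have hleni := length_le_of_subset (nodup_inter hXnd e.S) hXi
    have hlend := length_le_of_subset (nodup_diff hXnd e.S) hXd
    have hipos := List.length_pos_of_ne_nil hi
    have hdpos := List.length_pos_of_ne_nil hd
    obtain ⟨D₁, hD₁, t1, ht1, h1⟩ := ihl _ _ hl (inter A e.S) (by omega) (nodup_inter hnd _)
      (hA.inter_side hT hE he) (nodup_inter hXnd _) hXi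
      (fun H h1 h2 h3 h4 h5 => hsolve H h1 h2 h3 (fun y hy => (mem_inter.1 (h4 hy)).1)
        fun x hx hxH => h5 x (mem_inter.2 ⟨hx, (mem_inter.1 (h4 hxH)).2⟩) hxH)
    obtain ⟨D₂, hD₂, t2, ht2, h2⟩ := ihr _ _ hr' (diff A e.S) (by omega) (nodup_diff hnd _)
      (hA.diff_side hT hE he) (nodup_diff hXnd _) hXd
      (fun H h1 h2 h3 h4 h5 => hsolve H h1 h2 h3 (fun y hy => (mem_diff.1 (h4 hy)).1)
        fun x hx hxH => h5 x (mem_diff.2 ⟨hx, (mem_diff.1 (h4 hxH)).2⟩) hxH)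
    obtain ⟨t3, ht3, h3⟩ := computes_inter A e.S
    obtain ⟨t4, ht4, h4⟩ := computes_diff A e.S
    have hS : (60 * e.S.length + 60) * A.length ≤ (60 * s + 60) * r := by
      have := hs e he
      gcongr
    refine ⟨.node e.u e.v D₁ D₂, hD₁.node hE he hD₂ (fun C hC => by linarith)
      (fun C hC => by linarith), ?_⟩
    have hP : P * (A.length - X.length) = P * ((inter A e.S).length - (inter X e.S).length) +
        P * ((diff A e.S).length - (diff X e.S).length) := by
      rw [← mul_add]
      congr 1
      omega
    set R := (2 * ((60 * s + 60) * r) + 300) * (E.length + 1) with hRdef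
    have hR : 2 * ((60 * s + 60) * r) + 300 ≤ R := Nat.le_mul_of_pos_right _ (by omega)
    -- A strategy for `X` has `2 * |X| - 1` nodes, each of which is charged `R`.
    have hRX : R * (2 * X.length - 1) = R * (2 * (inter X e.S).length - 1) +
        R * (2 * (diff X e.S).length - 1) + R := by
      rw [← mul_add, ← Nat.mul_succ]
      congr 1
      omega
    rw [hP, hRX]
    unfold Computes
    rw [fn_prog (b := expandB) rfl]
    simp [expandB, comp, rest, encSk, encR, eS, encodeDecTree, h1, h2, h3, h4]
    omega

/-- The number `d` bounds the remaining depth: pieces satisfy `q * |H| < |A| ≤ q ^ d`. Each level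
adds `v ≤ C` for the strategy on `X` and `C` for the star. The time is charged to the elements of
the separator: they do not occur in the recursive calls, and `P` for each of them pays for the work
of one call. -/
theorem solves (hT : T.IsTree) (hE : IsTable T c E) (hc : ∀ e ∈ T.edgeSet, 0 ≤ c e)
    {s r q P : ℕ} (hs : ∀ e ∈ E, e.S.length ≤ s)
    (hP : 20 * r + 200 +
      (((60 * s + 60) * r + 80 * r + 40 * q + 300) * E.length + (60 * s + 60) * r + 200) * (r + 1) +
      (((60 * s + 60) * r + 80 * r + 300) * E.length + (60 * s + 60) * r + 700) *
        2 ^ ((q + 1) ^ 2 + 2 * (q + 1)) +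
      2 * ((2 * ((60 * s + 60) * r) + 300) * (E.length + 1)) ≤ P)
    (A : List (Fin n)) (hr : A.length ≤ r) (hnd : A.Nodup) (hne : A ≠ []) (hA : SplitClosed T A)
    (d : ℕ) (hd : A.length ≤ q ^ d) : Solves T c E q A (2 * (d + 1)) P := by
  induction hk : A.length using Nat.strong_induction_on generalizing A d with
  | _ k ih =>
  have hpos : 1 ≤ A.length := List.length_pos_of_ne_nil hne
  obtain ⟨X, hXnd, hXA, hXne, hXlen, hXsep, t1, ht1, h1⟩ := computes_sep (m := A.length) (q := q)
    hT hE hs hpos A hr hnd hA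
  have hXne := hXne hne
  have hXle : X.length ≤ q + 1 := by
    refine le_of_mul_le_mul_left (a := A.length) ?_ hpos
    rw [mul_add, mul_one, mul_comm A.length q]
    exact hXlen
  have hXr := length_le_of_subset hXnd hXA
  have hXpos : 1 ≤ X.length := List.length_pos_of_ne_nil hXne
  obtain ⟨v, K, hK, hv, t2, ht2, h2⟩ := findsBest hT hE hc hs X hXnd hXne (hXr.trans hr)
  obtain ⟨D, hD, t3, ht3, h3⟩ := computes_expand hT hE hc (q := q) (k := 2 * d) (P := P) hs K X v hK
    A hr hnd hA hXnd hXA (fun H hH1 hH2 hH3 hH4 hH5 => by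
      have hlt := hXsep H hH1 hH3 hH4 hH5
      have hHpos : 1 ≤ H.length := List.length_pos_of_ne_nil hH2
      obtain ⟨x, hx⟩ := List.exists_mem_of_ne_nil X hXne
      have hHA : H.length < A.length := by
        have := length_le_of_subset (List.nodup_cons.2 ⟨hH5 x hx, hH1⟩)
          (List.cons_subset.2 ⟨hXA hx, hH4⟩)
        simpa using this
      -- For `d = 0` the set `A` is a singleton, and there is no smaller nonempty `H`.
      cases d with
      | zero =>
        rw [pow_zero] at hd
        omega
      | succ d =>
        refine ih H.length (by omega) H (by omega) hH1 hH2 hH3 d ?_ rfl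
        rw [pow_succ, mul_comm] at hd
        exact (lt_of_mul_lt_mul_left (hlt.trans_le hd) (Nat.zero_le q)).le)
  refine ⟨D, hD.mono fun C hC => ?_, ?_⟩
  · have := hC.lowerBound_le X v hXne hv
    push_cast
    linarith
  obtain ⟨t4, ht4, h4⟩ := computes_len encodeVertex A
  have hsep : (((60 * s + 60) * r + 80 * r + 40 * q + 300) * E.length + (60 * s + 60) * r + 200) *
      (A.length + 1) ≤ (((60 * s + 60) * r + 80 * r + 40 * q + 300) * E.length +
        (60 * s + 60) * r + 200) * (r + 1) := by gcongr
  have hbest : (((60 * s + 60) * r + 80 * r + 300) * E.length + (60 * s + 60) * r + 700) *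
      2 ^ (X.length ^ 2 + 2 * X.length) ≤
      (((60 * s + 60) * r + 80 * r + 300) * E.length + (60 * s + 60) * r + 700) *
        2 ^ ((q + 1) ^ 2 + 2 * (q + 1)) := by
    gcongr
    simp
  set R := (2 * ((60 * s + 60) * r) + 300) * (E.length + 1) with hR
  clear_value R
  have hPX : P * A.length = P * X.length + P * (A.length - X.length) := by
    rw [← mul_add]
    congr 1
    omega
  have hPX' := Nat.mul_le_mul_right X.length hP
  have hRX : R * (2 * X.length - 1) ≤ 2 * R * X.length := by
    rw [mul_comm 2 R, mul_assoc]
    exact Nat.mul_le_mul_left R (Nat.sub_le _ _)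
  rw [add_mul _ (2 * R)] at hPX'
  have hT0 := Nat.le_mul_of_pos_right (20 * r + 200 +
      (((60 * s + 60) * r + 80 * r + 40 * q + 300) * E.length + (60 * s + 60) * r + 200) * (r + 1) +
      (((60 * s + 60) * r + 80 * r + 300) * E.length + (60 * s + 60) * r + 700) *
        2 ^ ((q + 1) ^ 2 + 2 * (q + 1))) hXpos
  rw [hPX]
  unfold Computes
  rw [fn_prog (b := solveB) rfl]
  simp [solveB, comp, rest, h1, h2, h3, h4]
  omega

/-! ### Lower bounds and the main result -/

open Classical in
/-- All edges at `x` have to be queried in order to identify `x`. -/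
theorem sum_cost_le_costAt {V : Type*} {T : SimpleGraph V} {c : Sym2 V → ℚ}
    (hc : ∀ e ∈ T.edgeSet, 0 ≤ c e) {x : V}
    (D : DecTree V) (hD : D.QueriesEdges T) (N : Finset V) (hN : ∀ w ∈ N, T.Adj w x)
    (hx : D.search T x = x) (hs : ∀ w ∈ N, D.search T w = w) :
    ∑ w ∈ N, c s(w, x) ≤ D.costAt T c x := by
  induction D generalizing N with
  | leaf y =>
    have : N = ∅ := by
      refine Finset.eq_empty_of_forall_notMem fun w hw => ?_
      exact (hN w hw).ne ((hs w hw).symm.trans hx)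
    simp [this, DecTree.costAt]
  | node p q l r ihl ihr =>
    obtain ⟨h1, h2, h3⟩ := hD
    -- A query accounts for at most one edge at `x`. The other neighbours stay on the side of `x`,
    -- so the subtree that `x` enters has to identify them too.
    have key : ∀ N' ⊆ N, (∀ w ∈ N', s(w, x) ≠ s(p, q)) → ∑ w ∈ N', c s(w, x) ≤
        if OnSide T p q x then l.costAt T c x else r.costAt T c x := by
      intro N' hsub hne
      have hside : ∀ w ∈ N', (OnSide T p q w ↔ OnSide T p q x) := fun w hw =>
        onSide_iff_of_adj (hN w (hsub hw)) (hne w hw)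
      rw [DecTree.search] at hx
      split_ifs at hx ⊢ with h
      · refine ihl h2 N' (fun w hw => hN w (hsub hw)) hx fun w hw => ?_
        have := hs w (hsub hw)
        rwa [DecTree.search, if_pos ((hside w hw).2 h)] at this
      · refine ihr h3 N' (fun w hw => hN w (hsub hw)) hx fun w hw => ?_
        have := hs w (hsub hw)
        rwa [DecTree.search, if_neg (fun h' => h ((hside w hw).1 h'))] at this
    rw [DecTree.costAt]
    by_cases hw0 : ∃ w ∈ N, s(w, x) = s(p, q)
    · obtain ⟨w, hw, he⟩ := hw0
      rw [← Finset.add_sum_erase N _ hw, he]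
      refine add_le_add_right (key _ (Finset.erase_subset _ _) fun w' hw' he' => ?_) _
      refine Finset.ne_of_mem_erase hw' ?_
      exact Sym2.congr_left.1 (he'.trans he.symm)
    · push Not at hw0
      have := key N (Finset.Subset.refl _) hw0
      have := hc s(p, q) h1
      linarith

/-- The table lists each directed edge once, so the list sum is a sum over distinct neighbours of
`x`. -/
theorem starSum_le_costAt (hE : IsTable T c E) (hc : ∀ e ∈ T.edgeSet, 0 ≤ c e)
    {D : DecTree (Fin n)} (hD : IsDecisionTree T D) (x : Fin n) :
    starSum E x ≤ D.costAt T c x := by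
  have hnd : ((E.filter fun e => e.v = x).map fun e => e.u).Nodup := by
    refine List.Nodup.of_map (fun w => (w, x)) ?_
    rw [List.map_map]
    convert hE.nodup.sublist ((List.filter_sublist (p := fun e => decide (e.v = x))).map _) using 1
    refine List.map_congr_left fun e he => ?_
    simp only [List.mem_filter, decide_eq_true_eq] at he
    simp [he.2]
  have hsum : starSum E x =
      ∑ w ∈ ((E.filter fun e => e.v = x).map fun e => e.u).toFinset, c s(w, x) := by
    rw [List.sum_toFinset _ hnd, List.map_map, starSum]
    congr 1
    refine List.map_congr_left fun e he => ?_
    simp only [List.mem_filter, decide_eq_true_eq] at he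
    simp [hE.cost_eq e he.1, he.2]
  rw [hsum]
  refine sum_cost_le_costAt hc D hD.1 _ (fun w hw => ?_) (hD.2.2 x) fun w _ => hD.2.2 w
  simp only [List.mem_toFinset, List.mem_map, List.mem_filter, decide_eq_true_eq] at hw
  obtain ⟨e, ⟨he, rfl⟩, rfl⟩ := hw
  exact hE.adj e he

/-- The largest cost in any decision tree `D'` satisfies `IsBound`. Hence `D` can be compared with
every `D'`, and then with the infimum. -/
theorem Handles.cost_le_opt (hT : T.IsTree) (hE : IsTable T c E)
    (hc : ∀ e ∈ T.edgeSet, 0 ≤ c e) {A : List (Fin n)} (hA : ∀ x, x ∈ A) {D : DecTree (Fin n)}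
    {k : ℕ} (hk : 0 < k) (hD : Handles T c E A D fun C => k * C) (hDT : IsDecisionTree T D) :
    cost T c D ≤ k * OPT T c := by
  have : Nonempty (Fin n) := hT.connected.nonempty
  have hk' : (0 : ℝ) < k := by exact_mod_cast hk
  rw [← div_le_iff₀' hk']
  refine le_csInf ⟨_, D, hDT, rfl⟩ ?_
  rintro _ ⟨D', hD', rfl⟩
  rw [div_le_iff₀' hk']
  obtain ⟨x₀, hx₀⟩ := Finite.exists_max fun x => D'.costAt T c x
  have hB : IsBound T c E (D'.costAt T c x₀) := by
    refine ⟨costAt_nonneg hc hD'.1 x₀, fun x => (starSum_le_costAt hE hc hD' x).trans (hx₀ x), ?_⟩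
    intro X v _ hv
    obtain ⟨x, -, hx⟩ := hv D' hD'.1 fun x _ => hD'.2.2 x
    exact hx.trans (hx₀ x)
  have hle : (D'.costAt T c x₀ : ℝ) ≤ cost T c D' :=
    le_ciSup (f := fun x => (D'.costAt T c x : ℝ)) (Set.finite_range _).bddAbove x₀
  refine ciSup_le fun x => ?_
  have := hD.cost_le _ hB x (hA x)
  calc (D.costAt T c x : ℝ) ≤ ((k * D'.costAt T c x₀ : ℚ) : ℝ) := by exact_mod_cast this
    _ = k * (D'.costAt T c x₀ : ℝ) := by push_cast; rfl
    _ ≤ k * cost T c D' := by gcongr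

/-! ### Estimates for the choice of `q` -/

theorem pow_search_le {q m : ℕ} (hq : 2 ≤ q) (h : 2 ^ q.choose 2 ≤ 2 * m) :
    2 ^ ((q + 1) ^ 2 + 2 * (q + 1)) ≤ 32 * (2 * m) ^ 10 := by
  -- The difference of the two sides is `(4 * q - 1) * (q - 2)`, with equality for `q = 2`.
  have hle : (q + 1) ^ 2 + 2 * (q + 1) ≤ 10 * q.choose 2 + 5 := by
    have h2 : 2 * q.choose 2 = q * (q - 1) := by
      rw [Nat.choose_two_right, Nat.mul_div_cancel' (Nat.even_mul_pred_self q).two_dvd]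
    obtain ⟨k, rfl⟩ : ∃ k, q = k + 2 := ⟨q - 2, by omega⟩
    rw [show k + 2 - 1 = k + 1 by omega] at h2
    nlinarith
  calc 2 ^ ((q + 1) ^ 2 + 2 * (q + 1)) ≤ 2 ^ (10 * q.choose 2 + 5) := by gcongr; simp
    _ = 32 * (2 ^ q.choose 2) ^ 10 := by rw [pow_add, mul_comm 10, pow_mul]; ring
    _ ≤ 32 * (2 * m) ^ 10 := by gcongr

/-- The program keeps `q` in unary, so `q` enters the running time polynomially. -/
theorem le_of_pow_choose_le {q m : ℕ} (hq : 2 ≤ q) (h : 2 ^ q.choose 2 ≤ 2 * m) : q ≤ 2 * m := by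
  have h2 : 2 * q.choose 2 = q * (q - 1) := by
    rw [Nat.choose_two_right, Nat.mul_div_cancel' (Nat.even_mul_pred_self q).two_dvd]
  have h3 : q - 1 ≤ q.choose 2 := by nlinarith [Nat.mul_le_mul_right (q - 1) hq]
  have h4 : 2 ^ (q - 1) ≤ 2 ^ q.choose 2 := Nat.pow_le_pow_right (by norm_num) h3
  have h5 : q - 1 < 2 ^ (q - 1) := Nat.lt_two_pow_self
  omega

theorem isBigO_clog {q : ℕ → ℕ} (hq : ∀ m, 1 ≤ m → 2 ≤ q m ∧ 2 * m < 2 ^ (q m + 1).choose 2) :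
    (fun m : ℕ => ((2 * (Nat.clog (q m) m + 1) : ℕ) : ℝ)) =O[Filter.atTop]
      fun m : ℕ => Real.log m / Real.log (Real.log m) := by
  -- With `y = log m / log (log m) ≥ 1` and `clog - 1 ≤ log m / log q ≤ 2 * y`, one gets `2 * (clog
  -- + 1) ≤ 4 * y + 4 ≤ 8 * y`. The threshold `3` exceeds `e`, so that `log (log m)` is positive.
  refine Asymptotics.IsBigO.of_bound 8 ?_
  filter_upwards [Filter.eventually_ge_atTop 3] with m hm
  obtain ⟨hq2, hqm⟩ := hq m (by omega)
  have hm0 : (0 : ℝ) < m := by positivity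
  have hm3 : (3 : ℝ) ≤ m := by exact_mod_cast hm
  have hlog1 : 1 < Real.log m := by
    rw [Real.lt_log_iff_exp_lt hm0]
    exact Real.exp_one_lt_d9.trans (by linarith)
  have hll : 0 < Real.log (Real.log m) := Real.log_pos hlog1
  have hll' : Real.log (Real.log m) ≤ Real.log m :=
    (Real.log_le_sub_one_of_pos (by linarith)).trans (by linarith)
  have hqpos : (1 : ℝ) < q m := by exact_mod_cast hq2
  have hlogq : 0 < Real.log (q m) := Real.log_pos hqpos
  have hsq : Real.log m ≤ (q m : ℝ) ^ 2 := by
    have h1 : (q m + 1).choose 2 ≤ q m ^ 2 := by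
      rw [Nat.choose_two_right]
      refine Nat.div_le_of_le_mul ?_
      rw [Nat.add_sub_cancel]
      nlinarith
    have h2 : m ≤ 2 ^ (q m ^ 2) := by
      have := Nat.pow_le_pow_right (n := 2) (by norm_num) h1
      omega
    have h3 : Real.log m ≤ Real.log ((2 : ℝ) ^ (q m ^ 2)) :=
      Real.log_le_log hm0 (by exact_mod_cast h2)
    rw [Real.log_pow] at h3
    refine h3.trans ?_
    push_cast
    have := Real.log_two_lt_d9
    nlinarith [sq_nonneg (q m : ℝ)]
  have hlq : Real.log (Real.log m) ≤ 2 * Real.log (q m) := by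
    have := Real.log_le_log (by linarith) hsq
    rwa [Real.log_pow, Nat.cast_ofNat] at this
  have hd : ((Nat.clog (q m) m : ℕ) : ℝ) - 1 ≤ Real.log m / Real.log (q m) := by
    rw [le_div_iff₀ hlogq]
    have h1 : q m ^ (Nat.clog (q m) m).pred < m := Nat.pow_pred_clog_lt_self (by omega) (by omega)
    have h2 : Real.log ((q m : ℝ) ^ (Nat.clog (q m) m).pred) ≤ Real.log m :=
      Real.log_le_log (by positivity) (by exact_mod_cast h1.le)
    rw [Real.log_pow] at h2
    refine le_trans ?_ h2
    have h3 : ((Nat.clog (q m) m : ℕ) : ℝ) - 1 ≤ ((Nat.clog (q m) m).pred : ℕ) := by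
      rw [sub_le_iff_le_add]
      have : Nat.clog (q m) m ≤ (Nat.clog (q m) m).pred + 1 := by
        rw [Nat.pred_eq_sub_one]
        omega
      exact_mod_cast this
    gcongr
  have hd2 : Real.log m / Real.log (q m) ≤ 2 * (Real.log m / Real.log (Real.log m)) := by
    rw [← mul_div_assoc, div_le_div_iff₀ hlogq hll]
    nlinarith
  have hone : 1 ≤ Real.log m / Real.log (Real.log m) := (one_le_div hll).2 hll'
  rw [Real.norm_of_nonneg (by positivity), Real.norm_of_nonneg (by linarith)]
  push_cast
  linarith

/-- The number of steps of the whole program is bounded by a polynomial. -/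
theorem exists_polynomial_time : ∃ p : Polynomial ℕ, ∀ m l q W : ℕ, l ≤ m → q ≤ 2 * m →
    W ≤ 32 * (2 * m) ^ 10 →
    30 * m + 20 + (40 * q + 100) * (q - 2 + 1) +
    ((120 * l + 2 * (((120 * (1 + 2 * m * m) + 200) * l + 60) * m) + 300) * l + 20) +
    (20 * m + 200 +
      (((60 * (1 + 2 * m * m) + 60) * m + 80 * m + 40 * q + 300) * (2 * l) +
        (60 * (1 + 2 * m * m) + 60) * m + 200) * (m + 1) +
      (((60 * (1 + 2 * m * m) + 60) * m + 80 * m + 300) * (2 * l) +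
        (60 * (1 + 2 * m * m) + 60) * m + 700) * W +
      2 * ((2 * ((60 * (1 + 2 * m * m) + 60) * m) + 300) * (2 * l + 1))) * m + 100 ≤ p.eval m := by
  -- Replace `l`, `q`, `q - 2` and `W` by their upper bounds; the expression is monotone in them.
  refine ⟨30 * .X + 20 + (40 * (2 * .X) + 100) * (2 * .X + 1) +
    ((120 * .X + 2 * (((120 * (1 + 2 * .X * .X) + 200) * .X + 60) * .X) + 300) * .X + 20) +
    (20 * .X + 200 +
      (((60 * (1 + 2 * .X * .X) + 60) * .X + 80 * .X + 40 * (2 * .X) + 300) * (2 * .X) +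
        (60 * (1 + 2 * .X * .X) + 60) * .X + 200) * (.X + 1) +
      (((60 * (1 + 2 * .X * .X) + 60) * .X + 80 * .X + 300) * (2 * .X) +
        (60 * (1 + 2 * .X * .X) + 60) * .X + 700) * (32 * (2 * .X) ^ 10) +
      2 * ((2 * ((60 * (1 + 2 * .X * .X) + 60) * .X) + 300) * (2 * .X + 1))) * .X + 100, ?_⟩
  intro m l q W hl hq hW
  simp only [Polynomial.eval_add, Polynomial.eval_mul, Polynomial.eval_pow, Polynomial.eval_X,
    Polynomial.eval_ofNat, Polynomial.eval_one]
  have hq' : q - 2 ≤ 2 * m := by omega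
  gcongr

end TreeSearch

/-! ### The main theorem -/

theorem theorem1 :
    ∃ (P : TreeSearch.Program) (p : Polynomial ℕ) (ρ : ℕ → ℝ),
      ρ =O[Filter.atTop] (fun n : ℕ => Real.log n / Real.log (Real.log n)) ∧
      ∀ (n : ℕ) (T : SimpleGraph (Fin n)) (c : Sym2 (Fin n) → ℚ) (L : List (Fin n × Fin n × ℚ)),
        T.IsTree → (∀ e ∈ T.edgeSet, 0 ≤ c e) → TreeSearch.ListsEdges T c L →
        ∃ (D : TreeSearch.DecTree (Fin n)) (t : ℕ),
          P.Outputs (TreeSearch.encodeInput n L) (TreeSearch.encodeDecTree D) t ∧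
          t ≤ p.eval n ∧
          TreeSearch.IsDecisionTree T D ∧
          TreeSearch.cost T c D ≤ ρ n * TreeSearch.OPT T c := by
  open TreeSearch in
  -- The number `q` depends on `m` alone, and so does the ratio. The value at `m = 0` is irrelevant
  -- because a tree has a vertex.
  have hfind : ∀ m : ℕ, ∃ q, 1 ≤ m → 2 ≤ q ∧ 2 ^ q.choose 2 ≤ 2 * m ∧
      2 * m < 2 ^ (q + 1).choose 2 ∧
      Computes 8 (.pair (.num m) (.pair (unary 2) (.num 1))) (unary q)
        ((40 * q + 100) * (q - 2 + 1)) := by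
    intro m
    by_cases hm : 1 ≤ m
    · obtain ⟨q, h⟩ := computes_find m 2 1 (by norm_num) le_rfl hm (by simp)
      exact ⟨q, fun _ => by simpa using h⟩
    · exact ⟨0, fun h => absurd h hm⟩
  choose q hq using hfind
  obtain ⟨p, hp⟩ := TreeSearch.exists_polynomial_time
  refine ⟨⟨TreeSearch.prog, TreeSearch.mainB⟩, p, _,
    TreeSearch.isBigO_clog fun m hm => ⟨(hq m hm).1, (hq m hm).2.2.1⟩, ?_⟩
  intro n T c L hT hc hL
  have hlen := hL.length_add_one hT
  have hE := TreeSearch.isTable_tableL hL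
  obtain ⟨hq2, hqle, -, t2, ht2, h2⟩ := hq n (by omega)
  obtain ⟨K, hKnd, hKmem, hKlen, t1, ht1, h1⟩ := TreeSearch.computes_iota (n := n) n le_rfl
  have hKall : ∀ x, x ∈ K := fun x => (hKmem x).2 x.2
  have hs : 1 + 2 * L.length * n ≤ 1 + 2 * n * n := by gcongr; omega
  obtain ⟨t3, ht3, h3⟩ := TreeSearch.computes_table TreeSearch.encodeVertex K L L (1 + 2 * n * n)
    (by rwa [hKlen])
  rw [hKlen] at h3 ht3
  -- The search starts with all vertices, which form a `SplitClosed` set trivially, and with depth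
  -- `Nat.clog (q n) n`.
  obtain ⟨D, hD, t4, ht4, h4⟩ := TreeSearch.solves (q := q n) (r := n) hT hE hc
    (fun e he => (TreeSearch.length_side_le he).trans hs) le_rfl K hKlen.le hKnd
    (List.ne_nil_of_length_pos (by omega)) (fun u v _ _ _ => ⟨hKall u, hKall v⟩)
    (Nat.clog (q n) n) (by rw [hKlen]; exact Nat.le_pow_clog (by omega) n)
  have hDT : TreeSearch.IsDecisionTree T D :=
    ⟨hD.queries, by rw [hD.numLeaves_eq, hKlen, Fintype.card_fin],
      fun x => hD.search_eq x (hKall x)⟩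
  have htime := hp n L.length (q n) _ (by omega) (TreeSearch.le_of_pow_choose_le hq2 hqle)
    (TreeSearch.pow_search_le hq2 hqle)
  rw [TreeSearch.length_tableL, hKlen] at ht4
  -- The main expression itself takes `31` steps, apart from the bodies of the four functions it
  -- calls.
  refine ⟨D, t1 + t2 + t3 + t4 + 31, ?_, by omega, hDT, hD.cost_le_opt hT hE hc hKall (by omega) hDT⟩
  refine (TreeSearch.run_eq_some (p := (_, _))).1 ?_
  simp only [TreeSearch.unary] at h2
  simp [TreeSearch.mainB, TreeSearch.comp, TreeSearch.rest, TreeSearch.encodeInput,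
    TreeSearch.encodeEdges_eq, h1, h2, h3, h4]
  omega
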